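/- Let $d\ge 1$, let $\kappa=(\kappa_1,\dots,\kappa_{d+1})\in\mathbb R^{d+1}$ with $\kappa_i>-1$ for all $i$, and let $n\in\mathbb N_0$. Write $(a)_k=a(a+1)\cdots(a+k-1)$, $|\kappa|=\kappa_1+\cdots+\kappa_{d+1}$, and for $\alpha\in\mathbb N_0^{d+1}$ write $|\alpha|=\sum_i\alpha_i$, $\alpha!=\prod_i\alpha_i!$, $(\kappa+\mathbf 1)_\alpha=\prod_{i=1}^{d+1}(\kappa_i+1)_{\alpha_i}$. *Orthogonality.* On the simplex $T^d=\{x\in\mathbb R^d: x_i\ge 0,\ x_1+\cdots+x_d\le 1\}$ let $$\langle f,g\rangle_{W_\kappa}=\frac{\Gamma(|\kappa|+d+1)}{\prod_{i=1}^{d+1}\Gamma(\kappa_i+1)}\int_{T^d}f(x)g(x)\,x_1^{\kappa_1}\cdots x_d^{\kappa_d}(1-x_1-\cdots-x_d)^{\kappa_{d+1}}\,dx .$$ A polynomial $P$ of degree at most $n$ is an orthogonal polynomial of degree $n$ if $\langle P,Q\rangle_{W_\kappa}=0$ for all polynomials $Q$ of degree at most $n-1$. *Monic polynomials.* For $\alpha\in\mathbb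 N_0^{d+1}$, $R_\alpha^\kappa$ is the (existing and unique) orthogonal polynomial of degree $|\alpha|$ of the form $R^\kappa_\alpha(x)=x_1^{\alpha_1}\cdots x_d^{\alpha_d}(1-x_1-\cdots-x_d)^{\alpha_{d+1}}+q_\alpha(x)$ with $\deg q_\alpha\le|\alpha|-1$. *Jacobi polynomials on the simplex.* For $\nu\in\mathbb N_0^d$ put $a_j=\sum_{i=j+1}^{d+1}\kappa_i+2\sum_{i=j+1}^{d}\nu_i+d-j$ for $1\le j\le d$, and let $P_\nu^\kappa$ be the polynomial $$P_\nu^\kappa(x)=\prod_{j=1}^d\left(\frac{1-x_1-\cdots-x_j}{1-x_1-\cdots-x_{j-1}}\right)^{\nu_{j+1}+\cdots+\nu_d} p_{\nu_j}^{(a_j,\kappa_j)}\!\left(\frac{2x_j}{1-x_1-\cdots-x_{j-1}}-1\right),$$ where $p_m^{(a,b)}(t)={}_2F_1\!\left(-m,\,m+a+b+1;\,a+1;\,\tfrac{1-t}{2}\right)$ is the Jacobi polynomial normalized by $p_m^{(a,b)}(1)=1$. *Hahn polynomials.* For $N\in\mathbb N_0$ and $|\nu|\le N$, the numbers $\mathsf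 H_\nu(\alpha;\kappa,N)$, $\alpha\in\mathbb N_0^{d+1}$, $|\alpha|=N$, are defined by $$|y|^N P_\nu^\kappa\!\left(\frac{y_1}{|y|},\dots,\frac{y_d}{|y|}\right)=\sum_{|\alpha|=N}\frac{N!}{\alpha!}\,\mathsf H_\nu(\alpha;\kappa,N)\,y^\alpha ,\qquad y\in\mathbb R^{d+1},\quad |y|=y_1+\cdots+y_{d+1},$$ and $$\mathsf B_\nu(\kappa,N)=\frac{N!}{(|\kappa|+d+1)_N}\sum_{|\alpha|=N}\mathsf H_\nu(\alpha;\kappa,N)^2\,\frac{(\kappa+\mathbf 1)_\alpha}{\alpha!}$$ is their squared norm for the normalized Hahn weight. **Theorem.** The Hahn polynomials are the connecting coefficients between the two families: for every $\nu\in\mathbb N_0^d$ with $|\nu|=n$, $$P_\nu^\kappa(x)=\sum_{\alpha\in\mathbb N_0^{d+1},\,|\alpha|=n}\frac{n!}{\alpha!}\,\mathsf H_\nu(\alpha;\kappa,n)\,R_\alpha^\kappa(x),$$ and, conversely, for every $\alpha\in\mathbb N_0^{d+1}$ with $|\alpha|=n$, $$R_\alpha^\kappa(x)=\frac{(\kappa+\mathbf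 1)_\alpha}{(|\kappa|+d+1)_n}\sum_{\nu\in\mathbb N_0^{d},\,|\nu|=n}\frac{\mathsf H_\nu(\alpha;\kappa,n)}{\mathsf B_\nu(\kappa,n)}\,P_\nu^\kappa(x).$$ -/

import Mathlib

open MeasureTheory

noncomputable section

namespace SimplexPoly

/-- The Pochhammer symbol `(a)_k = a (a + 1) ⋯ (a + k - 1)`. -/
def poch (a : ℝ) (k : ℕ) : ℝ := ∏ i ∈ Finset.range k, (a + i)

/-- The multi-index Pochhammer symbol `(κ + 𝟏)_α = ∏ i, (κ i + 1)_(α i)`. -/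
def pochSucc {d : ℕ} (κ : Fin (d + 1) → ℝ) (α : Fin (d + 1) → ℕ) : ℝ :=
  ∏ i, poch (κ i + 1) (α i)

/-- The multi-index factorial `α! = ∏ i, (α i)!`. -/
def multiFact {d : ℕ} (α : Fin (d + 1) → ℕ) : ℝ := ∏ i, ((α i).factorial : ℝ)

/-- `|κ| + d + 1`. -/
def lam {d : ℕ} (κ : Fin (d + 1) → ℝ) : ℝ := ∑ i, κ i + d + 1

/-! ### Orthogonality on the simplex -/

/-- The simplex `T^d = {x ∈ ℝ^d : x_i ≥ 0, |x| ≤ 1}`. -/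
def simplex (d : ℕ) : Set (Fin d → ℝ) := {x | (∀ i, 0 ≤ x i) ∧ ∑ i, x i ≤ 1}

/-- The Jacobi weight `x_1 ^ κ_1 ⋯ x_d ^ κ_d (1 - |x|) ^ κ_{d+1}`. -/
def jacobiWeight {d : ℕ} (κ : Fin (d + 1) → ℝ) (x : Fin d → ℝ) : ℝ :=
  (∏ i : Fin d, x i ^ κ i.castSucc) * (1 - ∑ i, x i) ^ κ (Fin.last d)

/-- The normalized inner product of polynomials with respect to the Jacobi weight. -/
def jacobiInner {d : ℕ} (κ : Fin (d + 1) → ℝ) (f g : MvPolynomial (Fin d) ℝ) : ℝ :=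
  Real.Gamma (lam κ) / (∏ i, Real.Gamma (κ i + 1)) *
    ∫ x in simplex d, MvPolynomial.eval x f * MvPolynomial.eval x g * jacobiWeight κ x

/-- The polynomials in `d` variables of degree at most `n - 1` (only `0` if `n = 0`). -/
def polyDegLT (d n : ℕ) : Submodule ℝ (MvPolynomial (Fin d) ℝ) :=
  MvPolynomial.restrictSupport ℝ {m | m.degree < n}

/-- `P` is an orthogonal polynomial of degree `n` for the Jacobi weight: it has degree at most
`n` and is orthogonal to all polynomials of degree at most `n - 1`. -/
def IsOrthogonalPoly {d : ℕ} (κ : Fin (d + 1) → ℝ) (n : ℕ) (P : MvPolynomial (Fin d) ℝ) : Prop :=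
  P.totalDegree ≤ n ∧ ∀ Q ∈ polyDegLT d n, jacobiInner κ P Q = 0

/-- The polynomial `X^α` in `x_1, …, x_d`, where `X = (x_1, …, x_d, 1 - |x|)`. -/
def homMonomial {d : ℕ} (α : Fin (d + 1) → ℕ) : MvPolynomial (Fin d) ℝ :=
  (∏ i : Fin d, MvPolynomial.X i ^ α i.castSucc) *
    (1 - ∑ i : Fin d, MvPolynomial.X i) ^ α (Fin.last d)

/-- `R` is an orthogonal polynomial of degree `|α|` of the form `X^α + q` with `deg q < |α|`. -/
def IsMonicOrthogonal {d : ℕ} (κ : Fin (d + 1) → ℝ) (α : Fin (d + 1) → ℕ)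
    (R : MvPolynomial (Fin d) ℝ) : Prop :=
  IsOrthogonalPoly κ (∑ i, α i) R ∧ ∃ q ∈ polyDegLT d (∑ i, α i), R = homMonomial α + q

/-- The monic orthogonal polynomial `R_α^κ`, i.e. the polynomial with the property
`IsMonicOrthogonal κ α` (its existence and uniqueness are part of the main statement). -/
def monicR {d : ℕ} (κ : Fin (d + 1) → ℝ) (α : Fin (d + 1) → ℕ) : MvPolynomial (Fin d) ℝ :=
  Classical.epsilon (IsMonicOrthogonal κ α)

/-! ### The mutually orthogonal Jacobi polynomials on the simplex -/

/-- The coefficients of `₂F₁(-n, n + a + b + 1; a + 1; z)`. -/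
def jacobiCoeff (n : ℕ) (a b : ℝ) (k : ℕ) : ℝ :=
  poch (-n) k * poch (n + a + b + 1) k / (poch (a + 1) k * k.factorial)

/-- The normalized Jacobi polynomial
`P_n^{(a,b)}(t) / P_n^{(a,b)}(1) = ₂F₁(-n, n + a + b + 1; a + 1; (1 - t) / 2)`. -/
def jacobiNormalized (n : ℕ) (a b t : ℝ) : ℝ :=
  ∑ k ∈ Finset.range (n + 1), jacobiCoeff n a b k * ((1 - t) / 2) ^ k

/-- The homogenization `v ^ n ₂F₁(-n, n + a + b + 1; a + 1; u / v)`, which is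
`v ^ n P_n^{(a,b)}(1 - 2 u / v) / P_n^{(a,b)}(1)`, as an element of an `ℝ`-algebra. -/
def jacobiHom {A : Type*} [CommRing A] [Algebra ℝ A] (n : ℕ) (a b : ℝ) (u v : A) : A :=
  ∑ k ∈ Finset.range (n + 1), algebraMap ℝ A (jacobiCoeff n a b k) * (u ^ k * v ^ (n - k))

theorem jacobiHom_eq (n : ℕ) (a b u v : ℝ) (hv : v ≠ 0) :
    jacobiHom n a b u v = v ^ n * jacobiNormalized n a b (1 - 2 * u / v) := by
  unfold jacobiHom jacobiNormalized
  rw [Finset.mul_sum]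
  refine Finset.sum_congr rfl fun k hk => ?_
  have hk' : k ≤ n := by simpa [Nat.lt_succ_iff] using hk
  have h1 : (1 - (1 - 2 * u / v)) / 2 = u / v := by ring
  rw [h1, div_pow, ← Nat.sub_add_cancel hk', pow_add]
  simp only [Nat.add_sub_cancel, Algebra.algebraMap_self, RingHom.id_apply]
  field_simp

theorem map_jacobiHom {A B : Type*} [CommRing A] [Algebra ℝ A] [CommRing B] [Algebra ℝ B]
    (f : A →ₐ[ℝ] B) (n : ℕ) (a b : ℝ) (u v : A) :
    f (jacobiHom n a b u v) = jacobiHom n a b (f u) (f v) := by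
  simp [jacobiHom]

/-- `a_j = |κ^{j+1}| + 2 |ν^{j+1}| + d - j` for `1 ≤ j ≤ d`; the index `j : Fin d` here stands
for `j + 1` there. -/
def aParam {d : ℕ} (κ : Fin (d + 1) → ℝ) (ν : Fin d → ℕ) (j : Fin d) : ℝ :=
  ∑ i with j.castSucc < i, κ i + 2 * ∑ i with j < i, (ν i : ℝ) + (d - ((j : ℕ) + 1 : ℝ))

/-- The Jacobi polynomial `P_ν^κ` on the simplex, written without denominators; `jacobiP_eval`
is the usual formula. -/
def jacobiP {d : ℕ} (κ : Fin (d + 1) → ℝ) (ν : Fin d → ℕ) : MvPolynomial (Fin d) ℝ :=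
  ∏ j : Fin d, jacobiHom (ν j) (aParam κ ν j) (κ j.castSucc)
    (1 - ∑ i with i ≤ j, MvPolynomial.X i) (1 - ∑ i with i < j, MvPolynomial.X i)

/-! ### Hahn polynomials -/

/-- The polynomial `P_{ν,N}(y) = |y|^N P_ν^κ(y' / |y|)`, where `y = (y', y_{d+1})`, that is
`|y|^{N-|ν|} ∏ j, |y^j|^{ν_j} P_{ν_j}^{(a_j,κ_j)}(2 y_j / |y^j| - 1) / P_{ν_j}^{(a_j,κ_j)}(1)`,
where `|y^j| = y_j + ⋯ + y_{d+1}`. -/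
def hahnGen {d : ℕ} (κ : Fin (d + 1) → ℝ) (ν : Fin d → ℕ) (N : ℕ) :
    MvPolynomial (Fin (d + 1)) ℝ :=
  (∑ i, MvPolynomial.X i) ^ (N - ∑ j, ν j) *
    ∏ j : Fin d, jacobiHom (ν j) (aParam κ ν j) (κ j.castSucc)
      (∑ i with j.castSucc < i, MvPolynomial.X i) (∑ i with j.castSucc ≤ i, MvPolynomial.X i)

/-- The Hahn polynomial `H_ν(α; κ, N)`, defined for `|ν| ≤ N` and `|α| = N` by the generating
function `P_{ν,N}(y) = ∑_{|α| = N} N! / α! H_ν(α; κ, N) y^α`. -/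
def hahn {d : ℕ} (κ : Fin (d + 1) → ℝ) (N : ℕ) (ν : Fin d → ℕ) (α : Fin (d + 1) → ℕ) : ℝ :=
  multiFact α / N.factorial *
    MvPolynomial.coeff (Finsupp.equivFunOnFinite.symm α) (hahnGen κ ν N)

/-- The inner product for the Hahn weight `(κ + 𝟏)_α / α!` on `{α ∈ ℕ₀^{d+1} : |α| = N}`,
normalized so that `⟨1, 1⟩ = 1`. -/
def hahnInner {d : ℕ} (κ : Fin (d + 1) → ℝ) (N : ℕ) (f g : (Fin (d + 1) → ℕ) → ℝ) : ℝ :=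
  N.factorial / poch (lam κ) N *
    ∑ α ∈ Finset.univ.piAntidiag N, f α * g α * (pochSucc κ α / multiFact α)

/-- `B_ν(κ, N) = ⟨H_ν(·; κ, N), H_ν(·; κ, N)⟩`. -/
def hahnNormSq {d : ℕ} (κ : Fin (d + 1) → ℝ) (N : ℕ) (ν : Fin d → ℕ) : ℝ :=
  hahnInner κ N (hahn κ N ν) (hahn κ N ν)

/-! ### The definitions agree with the usual formulas -/

theorem prod_ratio {d : ℕ} (x : Fin d → ℝ) (j : Fin d)
    (hx : ∀ j : Fin d, 1 - ∑ i with i < j, x i ≠ 0) :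
    ∏ i with i < j, ((1 - ∑ l with l ≤ i, x l) / (1 - ∑ l with l < i, x l)) =
      1 - ∑ l with l < j, x l := by
  obtain ⟨j, hj⟩ := j
  induction j with
  | zero =>
    have e : (Finset.univ.filter fun i : Fin d => i < ⟨0, hj⟩) = ∅ :=
      Finset.filter_eq_empty_iff.2 fun i _ h => Nat.not_lt_zero _ h
    simp [e]
  | succ j ih =>
    have e : (Finset.univ.filter fun i : Fin d => i < ⟨j + 1, hj⟩) =
        insert ⟨j, by omega⟩ (Finset.univ.filter fun i : Fin d => i < ⟨j, by omega⟩) := by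
      ext i
      simp only [Finset.mem_filter, Finset.mem_univ, true_and, Finset.mem_insert, Fin.lt_def,
        Fin.ext_iff]
      omega
    have e' : (Finset.univ.filter fun i : Fin d => i < ⟨j + 1, hj⟩) =
        Finset.univ.filter fun i : Fin d => i ≤ ⟨j, by omega⟩ := by
      ext i
      simp only [Finset.mem_filter, Finset.mem_univ, true_and, Fin.lt_def, Fin.le_def]
      omega
    rw [e, Finset.prod_insert (by simp), ih (by omega), ← e, e',
      div_mul_cancel₀ _ (hx ⟨j, by omega⟩)]

/-- The usual formula for `P_ν^κ`, at all points at which no denominator vanishes. -/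
theorem jacobiP_eval {d : ℕ} (κ : Fin (d + 1) → ℝ) (ν : Fin d → ℕ) (x : Fin d → ℝ)
    (hx : ∀ j : Fin d, 1 - ∑ i with i < j, x i ≠ 0) :
    MvPolynomial.eval x (jacobiP κ ν) =
      ∏ j : Fin d, ((1 - ∑ i with i ≤ j, x i) / (1 - ∑ i with i < j, x i)) ^ (∑ i with j < i, ν i) *
        jacobiNormalized (ν j) (aParam κ ν j) (κ j.castSucc)
          (2 * x j / (1 - ∑ i with i < j, x i) - 1) := by
  have h1 : ∀ j : Fin d, MvPolynomial.eval x (jacobiHom (ν j) (aParam κ ν j) (κ j.castSucc)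
      (1 - ∑ i with i ≤ j, MvPolynomial.X i) (1 - ∑ i with i < j, MvPolynomial.X i)) =
      (1 - ∑ i with i < j, x i) ^ ν j *
        jacobiNormalized (ν j) (aParam κ ν j) (κ j.castSucc)
          (2 * x j / (1 - ∑ i with i < j, x i) - 1) := by
    intro j
    have := map_jacobiHom (MvPolynomial.aeval x) (ν j) (aParam κ ν j) (κ j.castSucc)
      (1 - ∑ i with i ≤ j, MvPolynomial.X i) (1 - ∑ i with i < j, MvPolynomial.X i)
    simp only [MvPolynomial.aeval_eq_eval, map_sub, map_one, map_sum] at this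
    rw [this]
    simp only [MvPolynomial.eval_X]
    rw [jacobiHom_eq _ _ _ _ _ (hx j)]
    congr 2
    have e : (Finset.univ.filter fun i : Fin d => i ≤ j) =
        insert j (Finset.univ.filter fun i : Fin d => i < j) := by
      ext i; simp [le_iff_eq_or_lt]
    rw [e, Finset.sum_insert (by simp)]
    have := hx j
    field_simp
    ring
  unfold jacobiP
  rw [map_prod, Finset.prod_congr rfl fun j _ => h1 j, Finset.prod_mul_distrib,
    Finset.prod_mul_distrib]
  congr 1
  calc ∏ j, (1 - ∑ i with i < j, x i) ^ ν j
      = ∏ j, ∏ i with i < j, ((1 - ∑ l with l ≤ i, x l) / (1 - ∑ l with l < i, x l)) ^ ν j := by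
        refine Finset.prod_congr rfl fun j _ => ?_
        rw [Finset.prod_pow, prod_ratio x j hx]
    _ = _ := by
        simp only [← Finset.prod_pow_eq_pow_sum]
        exact Finset.prod_comm' (by simp)

theorem isHomogeneous_jacobiHom {σ : Type*} (n : ℕ) (a b : ℝ) (u v : MvPolynomial σ ℝ)
    (hu : u.IsHomogeneous 1) (hv : v.IsHomogeneous 1) :
    (jacobiHom n a b u v).IsHomogeneous n := by
  refine MvPolynomial.IsHomogeneous.sum _ _ _ fun k hk => ?_
  have hk' : k ≤ n := by simpa [Nat.lt_succ_iff] using hk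
  have h := (MvPolynomial.isHomogeneous_C σ (jacobiCoeff n a b k)).mul
    ((hu.pow k).mul (hv.pow (n - k)))
  have e : 0 + (1 * k + 1 * (n - k)) = n := by omega
  rw [e] at h
  exact h

theorem isHomogeneous_hahnGen {d : ℕ} (κ : Fin (d + 1) → ℝ) (ν : Fin d → ℕ) (N : ℕ)
    (hν : ∑ j, ν j ≤ N) : (hahnGen κ ν N).IsHomogeneous N := by
  have hs : ∀ s : Finset (Fin (d + 1)),
      (∑ i ∈ s, MvPolynomial.X i : MvPolynomial (Fin (d + 1)) ℝ).IsHomogeneous 1 := fun s =>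
    MvPolynomial.IsHomogeneous.sum _ _ _ fun i _ => MvPolynomial.isHomogeneous_X ℝ i
  have h := ((hs Finset.univ).pow (N - ∑ j, ν j)).mul
    (MvPolynomial.IsHomogeneous.prod Finset.univ
      (fun j : Fin d => jacobiHom (ν j) (aParam κ ν j) (κ j.castSucc)
        (∑ i with j.castSucc < i, MvPolynomial.X i)
        (∑ i with j.castSucc ≤ i, (MvPolynomial.X i : MvPolynomial (Fin (d + 1)) ℝ))) ν
      fun j _ => isHomogeneous_jacobiHom _ _ _ _ _ (hs _) (hs _))
  have e : 1 * (N - ∑ j, ν j) + ∑ j, ν j = N := by omega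
  rw [e] at h
  exact h

/-- The generating function that defines the Hahn polynomials. -/
theorem hahn_generating {d : ℕ} (κ : Fin (d + 1) → ℝ) (ν : Fin d → ℕ) (N : ℕ)
    (hν : ∑ j, ν j ≤ N) (y : Fin (d + 1) → ℝ) (hy : ∑ i, y i ≠ 0) :
    (∑ i, y i) ^ N *
        MvPolynomial.eval (fun i : Fin d => y i.castSucc / ∑ i, y i) (jacobiP κ ν) =
      ∑ α ∈ Finset.univ.piAntidiag N,
        N.factorial / multiFact α * hahn κ N ν α * ∏ i, y i ^ α i := by
  have hR : ∑ α ∈ Finset.univ.piAntidiag N,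
      N.factorial / multiFact α * hahn κ N ν α * ∏ i, y i ^ α i =
      MvPolynomial.eval y (hahnGen κ ν N) := by
    rw [MvPolynomial.eval_eq']
    symm
    refine Finset.sum_bij_ne_zero (fun m _ _ => (m : Fin (d + 1) → ℕ)) ?_ ?_ ?_ ?_
    · intro m hm _
      have := isHomogeneous_hahnGen κ ν N hν (MvPolynomial.mem_support_iff.1 hm)
      simpa [Finset.mem_piAntidiag, Finsupp.weight_apply, Finsupp.sum_fintype] using this
    · intro m _ _ m' _ _ h
      exact DFunLike.coe_injective h
    · intro α _ h
      refine ⟨Finsupp.equivFunOnFinite.symm α, ?_, ?_, rfl⟩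
      · rw [MvPolynomial.mem_support_iff]
        intro h0
        exact h (by simp [hahn, h0])
      · intro h0
        apply h
        rcases mul_eq_zero.1 h0 with h0 | h0
        · simp [hahn, h0]
        · simp only [Finsupp.equivFunOnFinite_symm_apply_apply] at h0
          simp [h0]
    · intro m _ _
      have h1 : multiFact (m : Fin (d + 1) → ℕ) ≠ 0 :=
        Finset.prod_ne_zero_iff.2 fun i _ => by positivity
      have h2 : (N.factorial : ℝ) ≠ 0 := by positivity
      have h3 : Finsupp.equivFunOnFinite.symm (m : Fin (d + 1) → ℕ) = m := by ext; simp
      rw [hahn, h3]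
      field_simp
  rw [hR]
  set s := ∑ i, y i with hs
  have key : ∀ (n : ℕ) (a b u v : ℝ), jacobiHom n a b u v = s ^ n * jacobiHom n a b (u / s) (v / s) := by
    intro n a b u v
    unfold jacobiHom
    rw [Finset.mul_sum]
    refine Finset.sum_congr rfl fun k hk => ?_
    have hk' : k ≤ n := by simpa [Nat.lt_succ_iff] using hk
    obtain ⟨m, rfl⟩ := Nat.exists_eq_add_of_le hk'
    rw [Nat.add_sub_cancel_left, div_pow, div_pow, pow_add]
    field_simp
  have hu : ∀ j : Fin d, (∑ i with j.castSucc < i, y i) / s =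
      1 - ∑ i with i ≤ j, y i.castSucc / s := by
    intro j
    rw [eq_sub_iff_add_eq, ← Finset.sum_div, ← add_div, div_eq_one_iff_eq hy, hs,
      ← Finset.sum_filter_add_sum_filter_not Finset.univ (fun i => j.castSucc < i) y]
    congr 1
    rw [Finset.sum_filter, Finset.sum_filter, Fin.sum_univ_castSucc]
    simp [not_lt, Fin.castSucc_lt_last]
  have hv : ∀ j : Fin d, (∑ i with j.castSucc ≤ i, y i) / s =
      1 - ∑ i with i < j, y i.castSucc / s := by
    intro j
    rw [eq_sub_iff_add_eq, ← Finset.sum_div, ← add_div, div_eq_one_iff_eq hy, hs,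
      ← Finset.sum_filter_add_sum_filter_not Finset.univ (fun i => j.castSucc ≤ i) y]
    congr 1
    rw [Finset.sum_filter, Finset.sum_filter, Fin.sum_univ_castSucc]
    simp [not_le, Fin.le_last]
  have m1 := fun j : Fin d => map_jacobiHom (MvPolynomial.aeval y) (ν j) (aParam κ ν j)
    (κ j.castSucc) (∑ i with j.castSucc < i, MvPolynomial.X i)
    (∑ i with j.castSucc ≤ i, MvPolynomial.X i)
  have m2 := fun j : Fin d => map_jacobiHom
    (MvPolynomial.aeval (fun i : Fin d => y i.castSucc / s)) (ν j) (aParam κ ν j)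
    (κ j.castSucc) (1 - ∑ i with i ≤ j, MvPolynomial.X i) (1 - ∑ i with i < j, MvPolynomial.X i)
  simp only [MvPolynomial.aeval_eq_eval, map_sub, map_one, map_sum] at m1 m2
  unfold hahnGen jacobiP
  simp only [map_mul, map_pow, map_prod, map_sum, m1, m2, MvPolynomial.eval_X]
  rw [Finset.prod_congr (s₁ := Finset.univ) rfl fun j _ => key (ν j) (aParam κ ν j) (κ j.castSucc)
      (∑ i with j.castSucc < i, y i) (∑ i with j.castSucc ≤ i, y i),
    Finset.prod_mul_distrib, Finset.prod_pow_eq_pow_sum, ← mul_assoc, ← hs, ← pow_add,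
    Nat.sub_add_cancel hν]
  simp only [hu, hv]

end SimplexPoly

end

/-!
The proof works with polynomials in the homogeneous coordinates `y = (x, 1 - |x|)`. Restriction to
the hyperplane `|y| = 1` (`dehom`) sends the generating function `hahnGen κ ν N` to `P_ν^κ` for
every `N ≥ |ν|`, so that `P_ν = ∑_{|α| = n} (n! / α!) H_ν(α; κ, n) X^α` exactly
(`jacobiP_eq_sum_homMonomial`). Since `X^α` and `R_α` differ by a polynomial of degree less than
`n`, the first expansion follows as soon as `P_ν` is orthogonal to these: two orthogonal
polynomials of degree `n` that agree up to lower degree are equal (`eq_of_sub_mem_polyDegLT`).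

For the converse, the `H_μ(·; κ, n)` with `|μ| ≤ n` are pairwise orthogonal for the Hahn weight
and as many as there are `α` with `|α| = n`. Hence the dual orthogonality
(`hahn_dual_orthogonality`) holds, and it inverts the formula above: `X^α` is
`(κ + 𝟏)_α / (|κ| + d + 1)_n ∑_{|μ| ≤ n} H_μ(α) / B_μ P_μ`. The terms with `|μ| < n` have lower
degree, and those with `|μ| = n` are orthogonal polynomials of degree `n`; so the latter form a
polynomial with the defining property of `R_α`. This also proves the existence of `R_α`.

Both orthogonality relations come from the operators `D_S = ∑ i ∈ S, (y_i ∂_i² + (κ_i + 1) ∂_i)`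
(`bessel`), which form an `sl₂`-triple with multiplication by `s_S = ∑ i ∈ S, y_i` and an affine
function of the Euler operator `E_S`. With `S_k = {k, …, d + 1}`, the product of the factors of
`hahnGen` with index at least `k` is homogeneous and annihilated by `D_(S_k)`
(`tailProd_harmonic`), by the recurrence of the hypergeometric coefficients.

* Orthogonality of the Hahn polynomials (`hahnForm_hahnGen`): multiplication by `s_S` is adjoint
  to `D_S` for the form in which the monomials are orthogonal and `y^α` has square norm
  `α! (κ + 𝟏)_α`. So the Casimir operators of the sets `S_k` are symmetric. The generating
  functions are joint eigenfunctions (`casimir_hahnGen`), and the eigenvalues determine the sums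
  `ν_k + ⋯ + ν_d`, hence `ν`.
* Orthogonality of `P_ν` to lower degrees (`jacobiInner_dehom_harmonic`): by the Dirichlet integral
  (`lintegral_jacobiWeight`), the integral over the simplex is, on homogeneous polynomials, a
  multiple of the functional `y^α ↦ (κ + 𝟏)_α` (`moment`). It satisfies Green's identity
  `⟨D p, q⟩ - ⟨p, D q⟩ = (deg p - deg q) ⟨p, q⟩` (`moment_green`), by which a polynomial in the
  kernel of `D` is orthogonal to all homogeneous polynomials of smaller degree.
-/

noncomputable section

namespace SimplexPoly

open MvPolynomial

/-! ### Pochhammer symbols -/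

theorem poch_succ (c : ℝ) (k : ℕ) : poch c (k + 1) = poch c k * (c + k) :=
  Finset.prod_range_succ _ _

theorem poch_pos {c : ℝ} (hc : 0 < c) (k : ℕ) : 0 < poch c k :=
  Finset.prod_pos fun i _ => by positivity

/-! ### Second-order operators on polynomials -/

section Operators

variable {σ : Type*}

/-- The operator `∑ i ∈ S, (y_i ∂_i² + (κ_i + 1) ∂_i)`. -/
def bessel (κ : σ → ℝ) (S : Finset σ) : MvPolynomial σ ℝ →ₗ[ℝ] MvPolynomial σ ℝ :=
  ∑ i ∈ S, (LinearMap.mulLeft ℝ (X i) ∘ₗ (pderiv i).toLinearMap ∘ₗ (pderiv i).toLinearMap +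
    (κ i + 1) • (pderiv i).toLinearMap)

theorem bessel_apply (κ : σ → ℝ) (S : Finset σ) (p : MvPolynomial σ ℝ) :
    bessel κ S p = ∑ i ∈ S, (X i * pderiv i (pderiv i p) + (κ i + 1) • pderiv i p) := by
  simp [bessel]

/-- The partial Euler operator `∑ i ∈ S, y_i ∂_i`. -/
def euler (S : Finset σ) : Derivation ℝ (MvPolynomial σ ℝ) (MvPolynomial σ ℝ) :=
  ∑ i ∈ S, (X i : MvPolynomial σ ℝ) • pderiv i

theorem euler_apply (S : Finset σ) (p : MvPolynomial σ ℝ) :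
    euler S p = ∑ i ∈ S, X i * pderiv i p := by
  unfold euler
  rw [← Derivation.coeFnAddMonoidHom_apply, map_sum, Finset.sum_apply]
  rfl

/-- The linear form `∑ i ∈ S, y_i`. -/
def linForm (S : Finset σ) : MvPolynomial σ ℝ := ∑ i ∈ S, X i

/-- The number `∑ i ∈ S, (κ_i + 1)`. -/
def wt (κ : σ → ℝ) (S : Finset σ) : ℝ := ∑ i ∈ S, (κ i + 1)

/-- The constants of a derivation, as a subalgebra. -/
def constants (D : Derivation ℝ (MvPolynomial σ ℝ) (MvPolynomial σ ℝ)) :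
    Subalgebra ℝ (MvPolynomial σ ℝ) where
  carrier := {p | D p = 0}
  mul_mem' := by
    intro a b ha hb
    simp only [Set.mem_ofPred_eq] at *
    simp [ha, hb]
  add_mem' := by
    intro a b ha hb
    simp only [Set.mem_ofPred_eq] at *
    simp [ha, hb]
  algebraMap_mem' := by simp

theorem mem_constants {D : Derivation ℝ (MvPolynomial σ ℝ) (MvPolynomial σ ℝ)}
    {p : MvPolynomial σ ℝ} : p ∈ constants D ↔ D p = 0 := Iff.rfl

theorem jacobiHom_mem {A : Subalgebra ℝ (MvPolynomial σ ℝ)} (n : ℕ) (a b : ℝ)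
    {u v : MvPolynomial σ ℝ} (hu : u ∈ A) (hv : v ∈ A) : jacobiHom n a b u v ∈ A :=
  A.sum_mem fun _ _ => A.mul_mem (A.algebraMap_mem _) (A.mul_mem (A.pow_mem hu _) (A.pow_mem hv _))

theorem derivation_pow_of_eq_self {D : Derivation ℝ (MvPolynomial σ ℝ) (MvPolynomial σ ℝ)}
    {u : MvPolynomial σ ℝ} (hu : D u = u) (l : ℕ) : D (u ^ l) = (l : ℝ) • u ^ l := by
  rcases l with _ | l
  · simp
  · rw [Derivation.leibniz_pow, hu]
    simp [smul_eq_C_mul, pow_succ]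

/-- A derivation that fixes `u` and `v` acts on homogeneous polynomials in `u` and `v` as the Euler
operator does. -/
theorem derivation_jacobiHom {D : Derivation ℝ (MvPolynomial σ ℝ) (MvPolynomial σ ℝ)}
    {u v : MvPolynomial σ ℝ} (hu : D u = u) (hv : D v = v) (n : ℕ) (a b : ℝ) :
    D (jacobiHom n a b u v) = (n : ℝ) • jacobiHom n a b u v := by
  rw [jacobiHom, map_sum, Finset.smul_sum]
  refine Finset.sum_congr rfl fun k hk => ?_
  have hk' : k ≤ n := Nat.lt_succ_iff.1 (Finset.mem_range.1 hk)
  have hn : (n : MvPolynomial σ ℝ) = k + (n - k : ℕ) := by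
    rw [← Nat.cast_add, Nat.add_sub_cancel' hk']
  rw [algebraMap_eq, ← smul_eq_C_mul, Derivation.map_smul, Derivation.leibniz,
    derivation_pow_of_eq_self hu, derivation_pow_of_eq_self hv]
  simp only [smul_eq_mul, smul_eq_C_mul, map_natCast, hn]
  ring

theorem pderiv_comm (i j : σ) (p : MvPolynomial σ ℝ) :
    pderiv i (pderiv j p) = pderiv j (pderiv i p) := by
  classical
  have h : ⁅(pderiv i : Derivation ℝ (MvPolynomial σ ℝ) (MvPolynomial σ ℝ)),
      (pderiv j : Derivation ℝ (MvPolynomial σ ℝ) (MvPolynomial σ ℝ))⁆ = 0 := by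
    refine derivation_ext fun k => ?_
    rw [Derivation.commutator_apply]
    simp only [pderiv_X, Pi.single_apply]
    split_ifs <;> simp
  have := congrArg (fun D => D p) h
  simpa [Derivation.commutator_apply, sub_eq_zero] using this

variable [DecidableEq σ]

theorem pderiv_linForm (S : Finset σ) (i : σ) :
    pderiv i (linForm S) = if i ∈ S then 1 else 0 := by
  simp [linForm, pderiv_X, Pi.single_apply]

theorem euler_linForm_of_subset {S T : Finset σ} (h : S ⊆ T) :
    euler T (linForm S) = linForm S := by
  simp only [euler_apply, pderiv_linForm, mul_ite, mul_one, mul_zero, Finset.sum_ite_mem,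
    Finset.inter_eq_right.2 h]
  rfl

/-- The `sl₂` commutation relation of the Bessel operator with multiplication by `∑ i ∈ S, y_i`. -/
theorem bessel_linForm_mul (κ : σ → ℝ) (S : Finset σ) (p : MvPolynomial σ ℝ) :
    bessel κ S (linForm S * p) =
      linForm S * bessel κ S p + 2 * euler S p + wt κ S • p := by
  rw [bessel_apply, bessel_apply, euler_apply, wt, Finset.mul_sum, Finset.mul_sum, Finset.sum_smul,
    ← Finset.sum_add_distrib, ← Finset.sum_add_distrib]
  refine Finset.sum_congr rfl fun i hi => ?_
  simp only [pderiv_mul, pderiv_linForm, hi, if_true, map_add, one_mul, smul_eq_C_mul]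
  ring

theorem bessel_linForm_pow_mul (κ : σ → ℝ) (S : Finset σ) (p : MvPolynomial σ ℝ) (e : ℝ)
    (he : euler S p = e • p) (l : ℕ) :
    bessel κ S (linForm S ^ l * p) =
      (l * (l - 1 + wt κ S + 2 * e)) • (linForm S ^ (l - 1) * p) +
        linForm S ^ l * bessel κ S p := by
  induction l with
  | zero => simp
  | succ l ih =>
    have h1 : euler S (linForm S ^ l * p) = (l + e : ℝ) • (linForm S ^ l * p) := by
      rw [Derivation.leibniz, he, derivation_pow_of_eq_self (euler_linForm_of_subset subset_rfl)]
      simp only [smul_eq_mul, smul_eq_C_mul, map_add]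
      ring
    have h2 : (l : MvPolynomial σ ℝ) * linForm S ^ (l - 1) * linForm S = l * linForm S ^ l := by
      rcases l with _ | l
      · simp
      · rw [mul_assoc, ← pow_succ]; rfl
    rw [pow_succ', mul_assoc, bessel_linForm_mul, ih, h1]
    simp only [smul_eq_C_mul, map_add, map_mul, map_sub, map_one, map_natCast, Nat.cast_add,
      Nat.cast_one, Nat.add_sub_cancel, map_ofNat]
    linear_combination (p * ((l : MvPolynomial σ ℝ) - 1 + C (wt κ S) + 2 * C e)) * h2

theorem bessel_insert_of_pderiv_eq_zero (κ : σ → ℝ) (S : Finset σ) (j : σ) (hj : j ∉ S)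
    (p : MvPolynomial σ ℝ) (hp : pderiv j p = 0) : bessel κ (insert j S) p = bessel κ S p := by
  simp [bessel_apply, Finset.sum_insert hj, hp]

theorem euler_insert_of_pderiv_eq_zero (S : Finset σ) (j : σ) (hj : j ∉ S)
    (p : MvPolynomial σ ℝ) (hp : pderiv j p = 0) : euler (insert j S) p = euler S p := by
  simp [euler_apply, Finset.sum_insert hj, hp]

/-- The recurrence of the hypergeometric coefficients. -/
theorem jacobiCoeff_succ (n : ℕ) (a b : ℝ) (ha : -1 < a) (k : ℕ) :
    (k + 1) * (k + 1 + a) * jacobiCoeff n a b (k + 1) +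
      (n - k) * (n + k + a + b + 1) * jacobiCoeff n a b k = 0 := by
  have h2 : a + 1 + k ≠ 0 := by positivity [show 0 < a + 1 by linarith]
  have hk := (poch_pos (show 0 < a + 1 by linarith) k).ne'
  have hf : (k.factorial : ℝ) ≠ 0 := by positivity
  rw [jacobiCoeff, jacobiCoeff, poch_succ, poch_succ, poch_succ, Nat.factorial_succ]
  push_cast
  field_simp
  ring

/-- One step in the construction of the harmonic polynomials: a harmonic polynomial `q` in the
variables of `S`, homogeneous of degree `m`, becomes a harmonic polynomial in the variables of
`S ∪ {j}` when it is multiplied by a homogenized Jacobi polynomial in `∑ i ∈ S, y_i` and `y_j`. -/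
theorem bessel_jacobiHom_mul (κ : σ → ℝ) (S : Finset σ) (j : σ) (hj : j ∉ S)
    (q : MvPolynomial σ ℝ) (m a : ℝ) (n : ℕ) (hqj : pderiv j q = 0) (hq : bessel κ S q = 0)
    (he : euler S q = m • q) (ha : a + 1 = wt κ S + 2 * m) (ha1 : -1 < a) :
    bessel κ (insert j S) (jacobiHom n a (κ j) (linForm S) (linForm (insert j S)) * q) = 0 := by
  set s := linForm S with hs
  set t := linForm (insert j S) with ht
  have hsj : pderiv j s = 0 := by simp [hs, pderiv_linForm, hj]
  have hterm : ∀ k r : ℕ, bessel κ (insert j S) (t ^ r * (s ^ k * q)) =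
      ((r : ℝ) * (r + 2 * k + a + κ j + 1)) • (t ^ (r - 1) * (s ^ k * q)) +
        ((k : ℝ) * (k + a)) • (t ^ r * (s ^ (k - 1) * q)) := by
    intro k r
    have hpj : pderiv j (s ^ k * q) = 0 := by
      simp [hsj, hqj]
    have hps : euler S (s ^ k) = (k : ℝ) • s ^ k :=
      derivation_pow_of_eq_self (euler_linForm_of_subset subset_rfl) k
    have hpe : euler (insert j S) (s ^ k * q) = (k + m) • (s ^ k * q) := by
      rw [euler_insert_of_pderiv_eq_zero _ _ hj _ hpj, Derivation.leibniz, he, hps]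
      simp only [smul_eq_mul, smul_eq_C_mul, map_add]
      ring
    rw [bessel_linForm_pow_mul _ _ _ _ hpe, bessel_insert_of_pderiv_eq_zero _ _ _ hj _ hpj,
      bessel_linForm_pow_mul _ _ _ _ he, hq]
    have hw : wt κ (insert j S) = κ j + 1 + wt κ S := by simp [wt, Finset.sum_insert hj]
    rw [hw, show (r : ℝ) - 1 + (κ j + 1 + wt κ S) + 2 * (k + m) = r + 2 * k + a + κ j + 1 by
      linear_combination -ha, show (k : ℝ) - 1 + wt κ S + 2 * m = k + a by linear_combination -ha]
    simp only [smul_eq_C_mul]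
    ring
  have hsum : jacobiHom n a (κ j) s t * q =
      ∑ k ∈ Finset.range (n + 1), jacobiCoeff n a (κ j) k • (t ^ (n - k) * (s ^ k * q)) := by
    rw [jacobiHom, Finset.sum_mul]
    refine Finset.sum_congr rfl fun k _ => ?_
    rw [algebraMap_eq, smul_eq_C_mul]
    ring
  rw [hsum, map_sum]
  simp only [map_smul, hterm, smul_add, Finset.sum_add_distrib]
  -- The first sum loses its last term and the second one its first; what is left cancels termwise.
  rw [Finset.sum_range_succ, Finset.sum_range_succ' (fun k => jacobiCoeff n a (κ j) k •
    ((k : ℝ) * (k + a)) • (t ^ (n - k) * (s ^ (k - 1) * q)))]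
  simp only [Nat.sub_self, Nat.cast_zero, zero_mul, zero_smul, smul_zero, add_zero]
  rw [← Finset.sum_add_distrib]
  refine Finset.sum_eq_zero fun k hk => ?_
  have hk' : k + 1 ≤ n := Finset.mem_range.1 hk
  rw [Nat.add_sub_cancel, Nat.sub_sub, smul_smul, smul_smul, ← add_smul, Nat.cast_sub (by omega)]
  have := jacobiCoeff_succ n a (κ j) ha1 k
  convert! zero_smul ℝ _ using 2
  push_cast
  linear_combination this

/-! ### Casimir operators -/

/-- The Casimir operator of the variables in `S`, that is `s D - E (E - 1 + λ)`, where
`s = ∑ i ∈ S, y_i`, `D` is the Bessel operator, `E` the Euler operator and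
`λ = ∑ i ∈ S, (κ_i + 1)`. -/
def casimir (κ : σ → ℝ) (S : Finset σ) (p : MvPolynomial σ ℝ) : MvPolynomial σ ℝ :=
  linForm S * bessel κ S p - (euler S (euler S p) + (wt κ S - 1) • euler S p)

/-- Harmonic polynomials of degree `m` are eigenfunctions of the Casimir operator, and remain so
when they are multiplied by a function that depends on the variables of `S` only through their
sum. -/
theorem casimir_mul (κ : σ → ℝ) (S : Finset σ) (i₀ : σ) (f q : MvPolynomial σ ℝ)
    (m : ℝ) (hf : ∀ i ∈ S, pderiv i f = pderiv i₀ f) (hq : bessel κ S q = 0)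
    (he : euler S q = m • q) :
    casimir κ S (f * q) = (-(m * (m - 1 + wt κ S))) • (f * q) := by
  set g := pderiv i₀ f with hg
  set h := pderiv i₀ g with hh
  have hg' : ∀ i ∈ S, pderiv i g = h := fun i hi => by rw [hg, pderiv_comm, hf i hi]
  have eul : ∀ r r' : MvPolynomial σ ℝ, (∀ i ∈ S, pderiv i r = r') →
      euler S r = linForm S * r' := by
    intro r r' hr
    rw [euler_apply, linForm, Finset.sum_mul]
    exact Finset.sum_congr rfl fun i hi => by rw [hr i hi]
  have e1 : euler S (f * q) = linForm S * g * q + m • (f * q) := by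
    rw [Derivation.leibniz, he, eul f g hf]
    simp only [smul_eq_mul, smul_eq_C_mul]
    ring
  have e2 : euler S (euler S (f * q)) = linForm S * g * q + linForm S ^ 2 * h * q +
      m • (linForm S * g * q) + m • (linForm S * g * q + m • (f * q)) := by
    rw [e1, map_add, Derivation.map_smul, e1, Derivation.leibniz, Derivation.leibniz, he,
      eul g h hg', euler_linForm_of_subset subset_rfl]
    simp only [smul_eq_mul, smul_eq_C_mul]
    ring
  have b : bessel κ S (f * q) =
      (linForm S * h + wt κ S • g) * q + (2 * m) • (g * q) := by
    have h1 : bessel κ S (f * q) =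
        (linForm S * h + wt κ S • g) * q + 2 * g * euler S q + f * bessel κ S q := by
      rw [bessel_apply, bessel_apply, euler_apply, wt, linForm]
      simp only [Finset.sum_mul, Finset.mul_sum, Finset.sum_smul, add_mul,
        ← Finset.sum_add_distrib]
      refine Finset.sum_congr rfl fun i hi => ?_
      simp only [pderiv_mul, map_add, hf i hi, hg' i hi, smul_eq_C_mul, map_one]
      ring
    rw [h1, hq, he]
    simp only [smul_eq_C_mul, map_mul, map_ofNat]
    ring
  rw [casimir, b, e2, e1]
  simp only [smul_eq_C_mul, map_sub, map_one, map_mul, map_add, map_neg, map_ofNat]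
  ring

end Operators

/-! ### Two forms on polynomials -/

section Forms

variable {d : ℕ}

theorem pochSucc_pos {κ : Fin (d + 1) → ℝ} (hκ : ∀ i, -1 < κ i) (α : Fin (d + 1) → ℕ) :
    0 < pochSucc κ α :=
  Finset.prod_pos fun i _ => poch_pos (by linarith [hκ i]) _

theorem multiFact_pos (α : Fin (d + 1) → ℕ) : 0 < multiFact α :=
  Finset.prod_pos fun i _ => by positivity

theorem pochSucc_add_single (κ : Fin (d + 1) → ℝ) (α : Fin (d + 1) →₀ ℕ) (i : Fin (d + 1)) :
    pochSucc κ (α + Finsupp.single i 1 : Fin (d + 1) →₀ ℕ) = (κ i + 1 + α i) * pochSucc κ α := by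
  rw [pochSucc, pochSucc, ← Finset.mul_prod_erase _ _ (Finset.mem_univ i),
    ← Finset.mul_prod_erase (a := i) _ (fun i => poch (κ i + 1) (α i)) (Finset.mem_univ i)]
  have : ∀ j ∈ Finset.univ.erase i, poch (κ j + 1) ((α + Finsupp.single i 1 : Fin (d + 1) →₀ ℕ) j) =
      poch (κ j + 1) (α j) := by
    intro j hj
    simp [(Finset.ne_of_mem_erase hj).symm]
  rw [Finset.prod_congr rfl this]
  simp only [Finsupp.coe_add, Pi.add_apply, Finsupp.single_eq_same, poch_succ]
  ring

theorem multiFact_add_single (α : Fin (d + 1) →₀ ℕ) (i : Fin (d + 1)) :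
    multiFact (α + Finsupp.single i 1 : Fin (d + 1) →₀ ℕ) = (α i + 1) * multiFact α := by
  rw [multiFact, multiFact, ← Finset.mul_prod_erase _ _ (Finset.mem_univ i),
    ← Finset.mul_prod_erase (a := i) _ (fun i => ((α i).factorial : ℝ)) (Finset.mem_univ i)]
  have : ∀ j ∈ Finset.univ.erase i,
      (((α + Finsupp.single i 1 : Fin (d + 1) →₀ ℕ) j).factorial : ℝ) =
      (α j).factorial := by
    intro j hj
    simp [(Finset.ne_of_mem_erase hj).symm]
  rw [Finset.prod_congr rfl this]
  simp only [Finsupp.coe_add, Pi.add_apply, Finsupp.single_eq_same, Nat.factorial_succ]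
  push_cast
  ring

/-- The linear functional `y^α ↦ (κ + 𝟏)_α`: up to a constant, integration against
`y^κ exp (-|y|)` over the positive orthant. -/
def moment (κ : Fin (d + 1) → ℝ) : MvPolynomial (Fin (d + 1)) ℝ →ₗ[ℝ] ℝ :=
  (basisMonomials (Fin (d + 1)) ℝ).constr ℝ fun α => pochSucc κ α

theorem moment_monomial (κ : Fin (d + 1) → ℝ) (α : Fin (d + 1) →₀ ℕ) (c : ℝ) :
    moment κ (monomial α c) = c * pochSucc κ α := by
  have h : moment κ (monomial α 1) = pochSucc κ α := by
    have := (basisMonomials (Fin (d + 1)) ℝ).constr_basis ℝ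
      (fun α : Fin (d + 1) →₀ ℕ => pochSucc κ α) α
    simpa [moment] using this
  rw [show monomial α c = c • (monomial α (1 : ℝ)) by simp [smul_monomial], map_smul, h,
    smul_eq_mul]

/-- The symmetric bilinear form on polynomials in which the monomials are orthogonal and `y^α` has
square norm `α! (κ + 𝟏)_α`. On homogeneous polynomials it is a multiple of the inner product for
the Hahn weight. -/
def hahnForm (κ : Fin (d + 1) → ℝ) :
    MvPolynomial (Fin (d + 1)) ℝ →ₗ[ℝ] MvPolynomial (Fin (d + 1)) ℝ →ₗ[ℝ] ℝ :=
  (basisMonomials (Fin (d + 1)) ℝ).constr ℝ fun α =>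
    (multiFact α * pochSucc κ α) • lcoeff ℝ α

theorem hahnForm_monomial_left (κ : Fin (d + 1) → ℝ) (α : Fin (d + 1) →₀ ℕ) (c : ℝ)
    (q : MvPolynomial (Fin (d + 1)) ℝ) :
    hahnForm κ (monomial α c) q = c * (multiFact α * pochSucc κ α) * coeff α q := by
  have h : hahnForm κ (monomial α 1) = (multiFact α * pochSucc κ α) • lcoeff ℝ α := by
    have := (basisMonomials (Fin (d + 1)) ℝ).constr_basis ℝ
      (fun α : Fin (d + 1) →₀ ℕ => (multiFact α * pochSucc κ α) • lcoeff ℝ α) α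
    simpa [hahnForm] using this
  rw [show monomial α c = c • (monomial α (1 : ℝ)) by simp [smul_monomial], map_smul, h]
  simp [mul_assoc]

theorem hahnForm_eq_sum (κ : Fin (d + 1) → ℝ) (p q : MvPolynomial (Fin (d + 1)) ℝ) :
    hahnForm κ p q =
      ∑ α ∈ p.support, multiFact α * pochSucc κ α * coeff α p * coeff α q := by
  conv_lhs => rw [p.as_sum]
  rw [map_sum, LinearMap.sum_apply]
  refine Finset.sum_congr rfl fun α _ => ?_
  rw [hahnForm_monomial_left]
  ring

theorem hahnForm_comm (κ : Fin (d + 1) → ℝ) (p q : MvPolynomial (Fin (d + 1)) ℝ) :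
    hahnForm κ p q = hahnForm κ q p := by
  induction p using MvPolynomial.induction_on' with
  | add p p' hp hp' => rw [map_add, LinearMap.add_apply, map_add, hp, hp']
  | monomial α a =>
    induction q using MvPolynomial.induction_on' with
    | add q q' hq hq' => rw [map_add, map_add, LinearMap.add_apply, hq, hq']
    | monomial β b =>
      rw [hahnForm_monomial_left, hahnForm_monomial_left, coeff_monomial, coeff_monomial]
      by_cases h : α = β
      · subst h; simp; ring
      · simp [h, Ne.symm h]

theorem coeff_bessel_term (κ : Fin (d + 1) → ℝ) (i : Fin (d + 1)) (α : Fin (d + 1) →₀ ℕ)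
    (q : MvPolynomial (Fin (d + 1)) ℝ) :
    coeff α (X i * pderiv i (pderiv i q) + (κ i + 1) • pderiv i q) =
      (α i + 1) * (κ i + 1 + α i) * coeff (α + Finsupp.single i 1) q := by
  have h : coeff α (X i * pderiv i (pderiv i q)) = α i * coeff α (pderiv i q) := by
    induction q using MvPolynomial.induction_on' with
    | add p q hp hq => simp only [map_add, mul_add, coeff_add, hp, hq]
    | monomial β b =>
      rw [pderiv_monomial, X_mul_pderiv_monomial, coeff_smul, coeff_monomial]
      split_ifs with h
      · rw [h]; simp
      · simp
  rw [coeff_add, coeff_smul, h, coeff_pderiv, smul_eq_mul]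
  ring

theorem hahnForm_X_mul (κ : Fin (d + 1) → ℝ) (i : Fin (d + 1))
    (p q : MvPolynomial (Fin (d + 1)) ℝ) :
    hahnForm κ (X i * p) q =
      hahnForm κ p (X i * pderiv i (pderiv i q) + (κ i + 1) • pderiv i q) := by
  induction p using MvPolynomial.induction_on' with
  | add p p' hp hp' =>
    rw [mul_add, map_add, LinearMap.add_apply, map_add (hahnForm κ), LinearMap.add_apply, hp, hp']
  | monomial α a =>
    have h : (X i : MvPolynomial (Fin (d + 1)) ℝ) * monomial α a =
        monomial (α + Finsupp.single i 1) a := by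
      rw [X, monomial_mul, one_mul, add_comm (Finsupp.single i 1)]
    rw [h, hahnForm_monomial_left, hahnForm_monomial_left, coeff_bessel_term,
      pochSucc_add_single, multiFact_add_single]
    ring

/-- For `hahnForm`, the Bessel operator is adjoint to multiplication by `∑ i ∈ S, y_i`. -/
theorem hahnForm_linForm_mul (κ : Fin (d + 1) → ℝ) (S : Finset (Fin (d + 1)))
    (p q : MvPolynomial (Fin (d + 1)) ℝ) :
    hahnForm κ (linForm S * p) q = hahnForm κ p (bessel κ S q) := by
  rw [linForm, Finset.sum_mul, map_sum, LinearMap.sum_apply, bessel_apply, map_sum]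
  exact Finset.sum_congr rfl fun i _ => hahnForm_X_mul κ i p q

theorem hahnForm_euler (κ : Fin (d + 1) → ℝ) (S : Finset (Fin (d + 1)))
    (p q : MvPolynomial (Fin (d + 1)) ℝ) :
    hahnForm κ (euler S p) q = hahnForm κ p (euler S q) := by
  rw [euler_apply, euler_apply, map_sum, LinearMap.sum_apply, map_sum]
  refine Finset.sum_congr rfl fun i _ => ?_
  induction p using MvPolynomial.induction_on' with
  | add p p' hp hp' =>
    rw [map_add, mul_add, map_add, LinearMap.add_apply, map_add, LinearMap.add_apply, hp, hp']
  | monomial α a =>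
    induction q using MvPolynomial.induction_on' with
    | add q q' hq hq' => rw [map_add, map_add, mul_add, map_add, hq, hq']
    | monomial β b =>
      rw [X_mul_pderiv_monomial, X_mul_pderiv_monomial, map_nsmul, map_nsmul,
        LinearMap.smul_apply, hahnForm_monomial_left, coeff_monomial]
      split_ifs with h
      · rw [h]
      · simp

theorem hahnForm_casimir (κ : Fin (d + 1) → ℝ) (S : Finset (Fin (d + 1)))
    (p q : MvPolynomial (Fin (d + 1)) ℝ) :
    hahnForm κ (casimir κ S p) q = hahnForm κ p (casimir κ S q) := by
  have h : hahnForm κ (linForm S * bessel κ S p) q =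
      hahnForm κ p (linForm S * bessel κ S q) := by
    rw [hahnForm_linForm_mul, hahnForm_comm, ← hahnForm_linForm_mul, hahnForm_comm]
  simp only [casimir, map_sub, map_add, map_smul, LinearMap.sub_apply, LinearMap.add_apply,
    LinearMap.smul_apply, h, hahnForm_euler]

/-- Integration by parts for the weight `y^κ exp (-|y|)`. -/
theorem moment_parts (κ : Fin (d + 1) → ℝ) (i : Fin (d + 1))
    (p : MvPolynomial (Fin (d + 1)) ℝ) :
    moment κ (X i * pderiv i p + (κ i + 1) • p) = moment κ (X i * p) := by
  induction p using MvPolynomial.induction_on' with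
  | add p p' hp hp' =>
    rw [mul_add, map_add (moment κ) (X i * p), ← hp, ← hp', ← map_add (moment κ)]
    congr 1
    rw [map_add, mul_add, smul_add]
    ring
  | monomial α a =>
    have h : (X i : MvPolynomial (Fin (d + 1)) ℝ) * monomial α a =
        monomial (α + Finsupp.single i 1) a := by
      rw [X, monomial_mul, one_mul, add_comm (Finsupp.single i 1)]
    rw [X_mul_pderiv_monomial, h, map_add, map_nsmul, map_smul, moment_monomial, moment_monomial,
      pochSucc_add_single]
    simp only [nsmul_eq_mul, smul_eq_mul]
    ring

/-- Green's identity for the Bessel operator. -/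
theorem moment_green (κ : Fin (d + 1) → ℝ) (p q : MvPolynomial (Fin (d + 1)) ℝ) {n m : ℕ}
    (hp : p.IsHomogeneous n) (hq : q.IsHomogeneous m) :
    moment κ (bessel κ Finset.univ p * q) - moment κ (p * bessel κ Finset.univ q) =
      (n - m) * moment κ (p * q) := by
  have key : ∀ (p q : MvPolynomial (Fin (d + 1)) ℝ) (n : ℕ), p.IsHomogeneous n →
      moment κ (bessel κ Finset.univ p * q) +
        moment κ (∑ i, X i * pderiv i p * pderiv i q) = n * moment κ (p * q) := by
    intro p q n hp
    have h : ∀ i, moment κ ((X i * pderiv i (pderiv i p) + (κ i + 1) • pderiv i p) * q) +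
        moment κ (X i * pderiv i p * pderiv i q) = moment κ (X i * pderiv i p * q) := by
      intro i
      rw [← map_add, mul_assoc (X i) (pderiv i p) q, ← moment_parts]
      congr 1
      rw [pderiv_mul]
      simp only [smul_eq_C_mul]
      ring
    rw [bessel_apply, Finset.sum_mul, map_sum, map_sum, ← Finset.sum_add_distrib]
    simp only [h]
    rw [← map_sum, ← Finset.sum_mul, hp.sum_X_mul_pderiv, smul_mul_assoc, map_nsmul, nsmul_eq_mul]
  have h1 := key p q n hp
  have h2 := key q p m hq
  rw [mul_comm (bessel κ Finset.univ q), mul_comm q] at h2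
  have h3 : (∑ i, X i * pderiv i q * pderiv i p : MvPolynomial (Fin (d + 1)) ℝ) =
      ∑ i, X i * pderiv i p * pderiv i q :=
    Finset.sum_congr rfl fun i _ => by ring
  rw [h3] at h2
  linear_combination h1 - h2

theorem isHomogeneous_bessel (κ : Fin (d + 1) → ℝ) (q : MvPolynomial (Fin (d + 1)) ℝ) {m : ℕ}
    (hq : q.IsHomogeneous (m + 1)) : (bessel κ Finset.univ q).IsHomogeneous m := by
  rw [bessel_apply]
  refine IsHomogeneous.sum _ _ _ fun i _ => ?_
  have h1 : (pderiv i q).IsHomogeneous m := hq.pderiv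
  refine IsHomogeneous.add ?_ ?_
  · rcases m with _ | m
    · have : pderiv i (pderiv i q) = 0 := by
        rw [← totalDegree_zero_iff_isHomogeneous, totalDegree_eq_zero_iff_eq_C] at h1
        rw [h1, pderiv_C]
      rw [this, mul_zero]
      exact isHomogeneous_zero _ _ _
    · have := (isHomogeneous_X ℝ i).mul (h1.pderiv (i := i))
      rwa [Nat.add_sub_cancel, add_comm 1] at this
  · rw [smul_eq_C_mul]
    simpa using (isHomogeneous_C _ (κ i + 1)).mul h1

/-- Harmonic polynomials are orthogonal to all homogeneous polynomials of smaller degree. -/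
theorem moment_harmonic_mul (κ : Fin (d + 1) → ℝ) (p : MvPolynomial (Fin (d + 1)) ℝ) {n : ℕ}
    (hp : p.IsHomogeneous n) (hb : bessel κ Finset.univ p = 0) (m : ℕ) (hm : m < n)
    (q : MvPolynomial (Fin (d + 1)) ℝ) (hq : q.IsHomogeneous m) : moment κ (p * q) = 0 := by
  have hg : moment κ (p * bessel κ Finset.univ q) = 0 → moment κ (p * q) = 0 := by
    intro h
    have := moment_green κ p q hp hq
    rw [hb, h, zero_mul, map_zero, sub_zero] at this
    have hne : (n : ℝ) - m ≠ 0 := sub_ne_zero.2 (by exact_mod_cast hm.ne')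
    exact (mul_eq_zero.1 this.symm).resolve_left hne
  induction m generalizing q with
  | zero =>
    apply hg
    rw [← totalDegree_zero_iff_isHomogeneous, totalDegree_eq_zero_iff_eq_C] at hq
    rw [hq, bessel_apply]
    simp
  | succ m ih =>
    have hq' := isHomogeneous_bessel κ q hq
    refine hg (ih (by omega) _ hq' fun h => ?_)
    have := moment_green κ p _ hp hq'
    rw [hb, h, zero_mul, map_zero, sub_zero] at this
    have hne : (n : ℝ) - m ≠ 0 := sub_ne_zero.2 (by exact_mod_cast (by omega : m < n).ne')
    exact (mul_eq_zero.1 this.symm).resolve_left hne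

end Forms

/-! ### Orthogonality of the Hahn polynomials -/

section Hahn

variable {d : ℕ}

/-- The indices `k, k + 1, …, d` of the variables `y_i` (counted from `0`). -/
def tailSet (d k : ℕ) : Finset (Fin (d + 1)) := {i | k ≤ (i : ℕ)}

theorem mem_tailSet {k : ℕ} {i : Fin (d + 1)} : i ∈ tailSet d k ↔ k ≤ (i : ℕ) := by
  simp [tailSet]

theorem tailSet_zero : tailSet d 0 = Finset.univ := by
  ext i; simp [mem_tailSet]

theorem tailSet_eq_insert (j : Fin d) :
    tailSet d j = insert j.castSucc (tailSet d (j + 1)) := by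
  ext i
  simp only [mem_tailSet, Finset.mem_insert, Fin.ext_iff, Fin.val_castSucc]
  omega

theorem wt_tailSet_pos {κ : Fin (d + 1) → ℝ} (hκ : ∀ i, -1 < κ i) {k : ℕ} (hk : k ≤ d) :
    0 < wt κ (tailSet d k) :=
  Finset.sum_pos (fun i _ => by linarith [hκ i]) ⟨Fin.last d, mem_tailSet.2 hk⟩

/-- The `j`-th factor of the generating function of the Hahn polynomials. -/
def factor (κ : Fin (d + 1) → ℝ) (ν : Fin d → ℕ) (j : Fin d) : MvPolynomial (Fin (d + 1)) ℝ :=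
  jacobiHom (ν j) (aParam κ ν j) (κ j.castSucc) (linForm (tailSet d (j + 1)))
    (linForm (tailSet d j))

/-- The product of the factors with index at least `k`. -/
def tailProd (κ : Fin (d + 1) → ℝ) (ν : Fin d → ℕ) (k : ℕ) : MvPolynomial (Fin (d + 1)) ℝ :=
  ∏ j ∈ (Finset.univ.filter fun j : Fin d => k ≤ (j : ℕ)), factor κ ν j

/-- The degree of `tailProd κ ν k`. -/
def tailDeg (ν : Fin d → ℕ) (k : ℕ) : ℕ :=
  ∑ j ∈ (Finset.univ.filter fun j : Fin d => k ≤ (j : ℕ)), ν j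

theorem filter_le_eq_insert (j : Fin d) :
    (Finset.univ.filter fun i : Fin d => (j : ℕ) ≤ i) =
      insert j (Finset.univ.filter fun i : Fin d => (j : ℕ) + 1 ≤ i) := by
  ext i
  simp only [Finset.mem_filter, Finset.mem_univ, true_and, Finset.mem_insert, Fin.ext_iff]
  omega

theorem tailProd_eq_mul (κ : Fin (d + 1) → ℝ) (ν : Fin d → ℕ) (j : Fin d) :
    tailProd κ ν j = factor κ ν j * tailProd κ ν (j + 1) := by
  rw [tailProd, filter_le_eq_insert, Finset.prod_insert (by simp), tailProd]

theorem tailDeg_eq_add (ν : Fin d → ℕ) (j : Fin d) :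
    tailDeg ν j = ν j + tailDeg ν (j + 1) := by
  rw [tailDeg, filter_le_eq_insert, Finset.sum_insert (by simp), tailDeg]

theorem eq_of_tailDeg_eq {ν μ : Fin d → ℕ} (h : ∀ k ≤ d, tailDeg ν k = tailDeg μ k) : ν = μ := by
  funext j
  have h1 := h j j.isLt.le
  have h2 := h (j + 1) j.isLt
  rw [tailDeg_eq_add, tailDeg_eq_add] at h1
  omega

theorem aParam_add_one (κ : Fin (d + 1) → ℝ) (ν : Fin d → ℕ) (j : Fin d) :
    aParam κ ν j + 1 = wt κ (tailSet d (j + 1)) + 2 * (tailDeg ν (j + 1) : ℕ) := by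
  have e1 : (Finset.univ.filter fun i : Fin (d + 1) => j.castSucc < i) = tailSet d (j + 1) := by
    ext i; simp [mem_tailSet, Fin.lt_def]
  have e2 : (Finset.univ.filter fun i : Fin d => j < i) =
      Finset.univ.filter fun i : Fin d => (j : ℕ) + 1 ≤ i := by
    ext i; simp
  have hc : (tailSet d (j + 1)).card = d - j := by
    rw [← e1, Finset.filter_lt_eq_Ioi, Fin.card_Ioi]
    simp
  rw [aParam, e1, e2, wt, Finset.sum_add_distrib, Finset.sum_const, hc, tailDeg, nsmul_eq_mul,
    Nat.cast_sub j.isLt.le]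
  push_cast
  ring

theorem neg_one_lt_aParam {κ : Fin (d + 1) → ℝ} (hκ : ∀ i, -1 < κ i) (ν : Fin d → ℕ)
    (j : Fin d) : -1 < aParam κ ν j := by
  have h1 := aParam_add_one κ ν j
  have h2 := wt_tailSet_pos hκ (Nat.succ_le_of_lt j.isLt)
  have h3 : (0 : ℝ) ≤ (tailDeg ν (j + 1) : ℕ) := Nat.cast_nonneg _
  rw [Nat.succ_eq_add_one] at h2
  linarith

theorem pderiv_tailProd (κ : Fin (d + 1) → ℝ) (ν : Fin d → ℕ) (k : ℕ) (i : Fin (d + 1))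
    (hi : (i : ℕ) < k) : pderiv i (tailProd κ ν k) = 0 := by
  have h : ∀ l, k ≤ l → linForm (tailSet d l) ∈ constants (pderiv i) := by
    intro l hl
    rw [mem_constants, pderiv_linForm, if_neg]
    rw [mem_tailSet]
    omega
  refine mem_constants.1 (Subalgebra.prod_mem _ fun j hj => ?_)
  have hj' : k ≤ (j : ℕ) := by simpa using hj
  exact jacobiHom_mem _ _ _ (h _ (by omega)) (h _ hj')

theorem euler_factor (κ : Fin (d + 1) → ℝ) (ν : Fin d → ℕ) (j : Fin d) :
    euler (tailSet d j) (factor κ ν j) = (ν j : ℝ) • factor κ ν j := by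
  refine derivation_jacobiHom (euler_linForm_of_subset fun i => ?_)
    (euler_linForm_of_subset subset_rfl) _ _ _
  simp only [mem_tailSet]
  omega

/-- The products of the last factors are harmonic and homogeneous in the variables that they
contain. -/
theorem tailProd_harmonic {κ : Fin (d + 1) → ℝ} (hκ : ∀ i, -1 < κ i) (ν : Fin d → ℕ) {k : ℕ}
    (hk : k ≤ d) : bessel κ (tailSet d k) (tailProd κ ν k) = 0 ∧
      euler (tailSet d k) (tailProd κ ν k) = (tailDeg ν k : ℝ) • tailProd κ ν k := by
  induction hk using Nat.decreasingInduction with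
  | self =>
    have e : (Finset.univ.filter fun i : Fin d => d ≤ (i : ℕ)) = ∅ :=
      Finset.filter_eq_empty_iff.2 fun i _ => by omega
    simp [tailProd, tailDeg, e, bessel_apply]
  | of_succ k hk ih =>
    set j : Fin d := ⟨k, hk⟩ with hj
    have hjk : (j : ℕ) = k := rfl
    rw [← hjk] at ih ⊢
    have hp := pderiv_tailProd κ ν (j + 1) j.castSucc (by simp)
    have hmem : j.castSucc ∉ tailSet d (j + 1) := by simp [mem_tailSet]
    rw [tailProd_eq_mul, tailDeg_eq_add]
    constructor
    · rw [factor, tailSet_eq_insert]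
      exact bessel_jacobiHom_mul κ _ _ hmem _ _ _ _ hp ih.1 ih.2 (aParam_add_one κ ν j)
        (neg_one_lt_aParam hκ ν j)
    · rw [Derivation.leibniz, euler_factor, tailSet_eq_insert,
        euler_insert_of_pderiv_eq_zero _ _ hmem _ hp, ih.2]
      simp only [smul_eq_mul, smul_eq_C_mul, Nat.cast_add, map_add]
      ring

/-- The factors of the generating function that involve the variables `y_k, y_(k+1), …` only
through the sums `y_l + y_(l+1) + ⋯` with `l ≤ k`. -/
def headProd (κ : Fin (d + 1) → ℝ) (ν : Fin d → ℕ) (N k : ℕ) : MvPolynomial (Fin (d + 1)) ℝ :=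
  linForm (tailSet d 0) ^ (N - ∑ j, ν j) *
    ∏ j ∈ (Finset.univ.filter fun j : Fin d => ¬ k ≤ (j : ℕ)), factor κ ν j

theorem hahnGen_eq (κ : Fin (d + 1) → ℝ) (ν : Fin d → ℕ) (N k : ℕ) :
    hahnGen κ ν N = headProd κ ν N k * tailProd κ ν k := by
  rw [headProd, tailProd, mul_assoc, mul_comm (Finset.prod _ _),
    Finset.prod_filter_mul_prod_filter_not, tailSet_zero, hahnGen]
  rfl

theorem pderiv_headProd (κ : Fin (d + 1) → ℝ) (ν : Fin d → ℕ) (N k : ℕ) (i i' : Fin (d + 1))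
    (hi : k ≤ (i : ℕ)) (hi' : k ≤ (i' : ℕ)) :
    pderiv i (headProd κ ν N k) = pderiv i' (headProd κ ν N k) := by
  have h : ∀ l, l ≤ k → linForm (tailSet d l) ∈ constants (pderiv i - pderiv i') := by
    intro l hl
    rw [mem_constants, Derivation.sub_apply, pderiv_linForm, pderiv_linForm,
      if_pos (mem_tailSet.2 (hl.trans hi)), if_pos (mem_tailSet.2 (hl.trans hi')), sub_self]
  rw [← sub_eq_zero, ← Derivation.sub_apply, ← mem_constants]
  refine Subalgebra.mul_mem _ (Subalgebra.pow_mem _ (h 0 (Nat.zero_le _)) _)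
    (Subalgebra.prod_mem _ fun j hj => ?_)
  have hj' : (j : ℕ) < k := by simpa using hj
  exact jacobiHom_mem _ _ _ (h _ (by omega)) (h _ hj'.le)

theorem casimir_hahnGen {κ : Fin (d + 1) → ℝ} (hκ : ∀ i, -1 < κ i) (ν : Fin d → ℕ) (N : ℕ)
    {k : ℕ} (hk : k ≤ d) : casimir κ (tailSet d k) (hahnGen κ ν N) =
      (-((tailDeg ν k : ℝ) * (tailDeg ν k - 1 + wt κ (tailSet d k)))) • hahnGen κ ν N := by
  have h := tailProd_harmonic hκ ν hk
  rw [hahnGen_eq κ ν N k]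
  exact casimir_mul κ _ (Fin.last d) _ _ _
    (fun i hi => pderiv_headProd κ ν N k i _ (mem_tailSet.1 hi) hk) h.1 h.2

theorem bessel_hahnGen {κ : Fin (d + 1) → ℝ} (hκ : ∀ i, -1 < κ i) (ν : Fin d → ℕ) :
    bessel κ Finset.univ (hahnGen κ ν (∑ j, ν j)) = 0 := by
  have h := (tailProd_harmonic hκ ν (Nat.zero_le d)).1
  rw [hahnGen_eq κ ν _ 0]
  simpa [headProd, tailSet_zero] using h

/-- The generating functions are joint eigenfunctions of symmetric operators, with different
eigenvalues for different indices. -/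
theorem hahnForm_hahnGen {κ : Fin (d + 1) → ℝ} (hκ : ∀ i, -1 < κ i) {ν μ : Fin d → ℕ}
    (h : ν ≠ μ) (N : ℕ) : hahnForm κ (hahnGen κ ν N) (hahnGen κ μ N) = 0 := by
  obtain ⟨k, hk, hne⟩ : ∃ k ≤ d, tailDeg ν k ≠ tailDeg μ k := by
    by_contra! hc
    exact h (eq_of_tailDeg_eq hc)
  have hs := hahnForm_casimir κ (tailSet d k) (hahnGen κ ν N) (hahnGen κ μ N)
  rw [casimir_hahnGen hκ ν N hk, casimir_hahnGen hκ μ N hk, map_smul, map_smul,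
    LinearMap.smul_apply, smul_eq_mul, smul_eq_mul] at hs
  have h0 := wt_tailSet_pos hκ hk
  have h1 : (tailDeg ν k : ℝ) - tailDeg μ k ≠ 0 := sub_ne_zero.2 (by exact_mod_cast hne)
  have h2 : 0 < (tailDeg ν k : ℝ) + tailDeg μ k - 1 + wt κ (tailSet d k) := by
    have : (1 : ℝ) ≤ (tailDeg ν k : ℝ) + tailDeg μ k := by
      exact_mod_cast (by omega : 1 ≤ tailDeg ν k + tailDeg μ k)
    linarith
  have h3 : ((tailDeg ν k : ℝ) - tailDeg μ k) *
      ((tailDeg ν k : ℝ) + tailDeg μ k - 1 + wt κ (tailSet d k)) *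
      hahnForm κ (hahnGen κ ν N) (hahnGen κ μ N) = 0 := by
    linear_combination -hs
  exact (mul_eq_zero.1 h3).resolve_left (mul_ne_zero h1 h2.ne')

/-- A sum over the support of a homogeneous polynomial as a sum over multi-indices. -/
theorem sum_support_eq_sum_piAntidiag {p : MvPolynomial (Fin (d + 1)) ℝ} {N : ℕ}
    (hp : p.IsHomogeneous N) {M : Type*} [AddCommMonoid M] (f : (Fin (d + 1) →₀ ℕ) → M)
    (hf : ∀ α, coeff α p = 0 → f α = 0) :
    ∑ α ∈ p.support, f α =
      ∑ α ∈ Finset.univ.piAntidiag N, f (Finsupp.equivFunOnFinite.symm α) := by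
  refine Eq.trans ?_
    (Finset.sum_map (Finset.univ.piAntidiag N) Finsupp.equivFunOnFinite.symm.toEmbedding f)
  refine Finset.sum_subset (fun m hm => ?_) fun m _ hm => hf m (notMem_support_iff.1 hm)
  rw [Finset.mem_map_equiv]
  have := hp (mem_support_iff.1 hm)
  simpa [Finset.mem_piAntidiag, Finsupp.weight_apply, Finsupp.sum_fintype] using this

theorem coeff_hahnGen (κ : Fin (d + 1) → ℝ) (ν : Fin d → ℕ) (N : ℕ) (α : Fin (d + 1) → ℕ) :
    coeff (Finsupp.equivFunOnFinite.symm α) (hahnGen κ ν N) =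
      N.factorial / multiFact α * hahn κ N ν α := by
  have h1 := (multiFact_pos α).ne'
  have h2 : (N.factorial : ℝ) ≠ 0 := by positivity
  rw [hahn]
  field_simp

theorem hahnInner_hahn (κ : Fin (d + 1) → ℝ) (N : ℕ) (ν μ : Fin d → ℕ) (hν : ∑ j, ν j ≤ N) :
    hahnInner κ N (hahn κ N ν) (hahn κ N μ) =
      (N.factorial * poch (lam κ) N)⁻¹ * hahnForm κ (hahnGen κ ν N) (hahnGen κ μ N) := by
  rw [hahnForm_eq_sum, sum_support_eq_sum_piAntidiag (isHomogeneous_hahnGen κ ν N hν) _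
    (fun α h => by rw [h]; ring), hahnInner, Finset.mul_sum, Finset.mul_sum]
  refine Finset.sum_congr rfl fun α _ => ?_
  rw [coeff_hahnGen, coeff_hahnGen, Finsupp.coe_equivFunOnFinite_symm]
  have h1 := (multiFact_pos α).ne'
  have h2 : (N.factorial : ℝ) ≠ 0 := by positivity
  rw [mul_inv, div_eq_mul_inv (N.factorial : ℝ) (poch _ _)]
  field_simp

theorem hahnInner_eq_zero {κ : Fin (d + 1) → ℝ} (hκ : ∀ i, -1 < κ i) {ν μ : Fin d → ℕ}
    (h : ν ≠ μ) (N : ℕ) (hν : ∑ j, ν j ≤ N) :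
    hahnInner κ N (hahn κ N ν) (hahn κ N μ) = 0 := by
  rw [hahnInner_hahn κ N ν μ hν, hahnForm_hahnGen hκ h, mul_zero]

theorem lam_eq_wt (κ : Fin (d + 1) → ℝ) : lam κ = wt κ (tailSet d 0) := by
  rw [tailSet_zero, wt, lam, Finset.sum_add_distrib]
  simp [add_assoc]

theorem lam_pos {κ : Fin (d + 1) → ℝ} (hκ : ∀ i, -1 < κ i) : 0 < lam κ := by
  rw [lam_eq_wt]
  exact wt_tailSet_pos hκ (Nat.zero_le d)

theorem factor_ne_zero (κ : Fin (d + 1) → ℝ) (ν : Fin d → ℕ) (j : Fin d) :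
    factor κ ν j ≠ 0 := by
  -- At the `j`-th unit vector the factor is the Jacobi polynomial at `1`.
  intro h
  have h1 : ∀ k, eval (Pi.single j.castSucc (1 : ℝ)) (linForm (tailSet d k)) =
      if k ≤ (j : ℕ) then 1 else 0 := by
    intro k
    simp [linForm, Pi.single_apply, mem_tailSet]
  have h2 := congrArg (aeval (Pi.single j.castSucc (1 : ℝ))) h
  rw [factor, map_jacobiHom, map_zero, aeval_eq_eval] at h2
  rw [h1, h1, if_pos le_rfl, if_neg (by omega), jacobiHom,
    Finset.sum_range_succ', Finset.sum_eq_zero (fun k _ => by simp)] at h2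
  simp [jacobiCoeff, poch] at h2

theorem hahnGen_ne_zero (κ : Fin (d + 1) → ℝ) (ν : Fin d → ℕ) (N : ℕ) : hahnGen κ ν N ≠ 0 := by
  rw [hahnGen_eq κ ν N 0]
  refine mul_ne_zero (mul_ne_zero (pow_ne_zero _ fun h => ?_)
    (Finset.prod_ne_zero_iff.2 fun j _ => factor_ne_zero κ ν j))
    (Finset.prod_ne_zero_iff.2 fun j _ => factor_ne_zero κ ν j)
  have := congrArg (pderiv 0) h
  simp [pderiv_linForm, mem_tailSet] at this

theorem hahnNormSq_pos {κ : Fin (d + 1) → ℝ} (hκ : ∀ i, -1 < κ i) (ν : Fin d → ℕ) (N : ℕ)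
    (hν : ∑ j, ν j ≤ N) : 0 < hahnNormSq κ N ν := by
  have h1 := poch_pos (lam_pos hκ) N
  rw [hahnNormSq, hahnInner_hahn κ N ν ν hν, hahnForm_eq_sum]
  refine mul_pos (by positivity) (Finset.sum_pos (fun α hα => ?_) ?_)
  · have h2 := mul_pos (multiFact_pos α) (pochSucc_pos hκ α)
    have h3 := mul_self_pos.2 (mem_support_iff.1 hα)
    rw [mul_assoc]
    exact mul_pos h2 h3
  · exact support_nonempty.2 (hahnGen_ne_zero κ ν N)

end Hahn

/-! ### The Dirichlet integral -/

section Dirichlet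

variable {d : ℕ}

/-- The density `y ^ k exp (-y)` on the half-line `y ≥ 0`, extended by zero. -/
def gammaDensity (k : ℝ) : ℝ → ℝ := (Set.Ici 0).indicator fun y => Real.exp (-y) * y ^ k

theorem gammaDensity_nonneg (k y : ℝ) : 0 ≤ gammaDensity k y :=
  Set.indicator_nonneg (fun _ hy => mul_nonneg (Real.exp_pos _).le (Real.rpow_nonneg hy _)) _

theorem measurable_gammaDensity (k : ℝ) : Measurable (gammaDensity k) :=
  Measurable.indicator (by fun_prop) measurableSet_Ici

theorem integrable_gammaDensity {k : ℝ} (hk : -1 < k) : Integrable (gammaDensity k) := by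
  rw [gammaDensity, integrable_indicator_iff measurableSet_Ici,
    integrableOn_Ici_iff_integrableOn_Ioi]
  simpa using Real.GammaIntegral_convergent (s := k + 1) (by linarith)

theorem integral_gammaDensity {k : ℝ} (hk : -1 < k) :
    ∫ y, gammaDensity k y = Real.Gamma (k + 1) := by
  rw [gammaDensity, integral_indicator measurableSet_Ici, integral_Ici_eq_integral_Ioi,
    Real.Gamma_eq_integral (by linarith)]
  simp

theorem lintegral_gammaDensity {k : ℝ} (hk : -1 < k) :
    ∫⁻ y, ENNReal.ofReal (gammaDensity k y) = ENNReal.ofReal (Real.Gamma (k + 1)) := by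
  rw [← ofReal_integral_eq_lintegral_ofReal (integrable_gammaDensity hk)
    (Filter.Eventually.of_forall (gammaDensity_nonneg k)), integral_gammaDensity hk]

theorem lintegral_prod_gammaDensity {k : Fin d → ℝ} (hk : ∀ i, -1 < k i) :
    ∫⁻ x : Fin d → ℝ, ENNReal.ofReal (∏ i, gammaDensity (k i) (x i)) =
      ENNReal.ofReal (∏ i, Real.Gamma (k i + 1)) := by
  have hint : Integrable fun x : Fin d → ℝ => ∏ i, gammaDensity (k i) (x i) :=
    Integrable.fintype_prod fun i => integrable_gammaDensity (hk i)
  rw [← ofReal_integral_eq_lintegral_ofReal hint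
    (Filter.Eventually.of_forall fun x => Finset.prod_nonneg fun i _ => gammaDensity_nonneg _ _),
    integral_fintype_prod_volume_eq_prod]
  simp only [integral_gammaDensity (hk _)]

theorem measurableSet_simplex (d : ℕ) : MeasurableSet (simplex d) := by
  have h : simplex d = (⋂ i, {x : Fin d → ℝ | 0 ≤ x i}) ∩ {x | ∑ i, x i ≤ 1} := by
    ext x; simp [simplex]
  rw [h]
  exact (MeasurableSet.iInter fun i => measurableSet_le (by fun_prop) (by fun_prop)).inter
    (measurableSet_le (by fun_prop) (by fun_prop))

theorem measurable_jacobiWeight (κ : Fin (d + 1) → ℝ) : Measurable (jacobiWeight κ) := by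
  unfold jacobiWeight
  fun_prop

theorem jacobiWeight_nonneg (κ : Fin (d + 1) → ℝ) {x : Fin d → ℝ} (hx : x ∈ simplex d) :
    0 ≤ jacobiWeight κ x :=
  mul_nonneg (Finset.prod_nonneg fun i _ => Real.rpow_nonneg (hx.1 i) _)
    (Real.rpow_nonneg (sub_nonneg.2 hx.2) _)

/-- In the coordinates `y = (t u, t (1 - |u|))`, the density `y^κ exp (-|y|)` is a product of a
function of `t` and the Jacobi weight at `u`. -/
theorem prod_gammaDensity_smul (κ : Fin (d + 1) → ℝ) {t : ℝ} (ht : 0 < t) (u : Fin d → ℝ) :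
    (∏ i : Fin d, gammaDensity (κ i.castSucc) (t * u i)) *
        gammaDensity (κ (Fin.last d)) (t - ∑ i, t * u i) =
      Real.exp (-t) * t ^ (∑ i, κ i) * (simplex d).indicator (jacobiWeight κ) u := by
  have hs : t - ∑ i, t * u i = t * (1 - ∑ i, u i) := by rw [← Finset.mul_sum]; ring
  rw [hs]
  by_cases hu : u ∈ simplex d
  · have h1 : 0 ≤ 1 - ∑ i, u i := sub_nonneg.2 hu.2
    have h2 : ∀ i : Fin d, gammaDensity (κ i.castSucc) (t * u i) =
        Real.exp (-(t * u i)) * (t ^ κ i.castSucc * u i ^ κ i.castSucc) := fun i => by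
      rw [gammaDensity, Set.indicator_of_mem (Set.mem_Ici.2 (mul_nonneg ht.le (hu.1 i))),
        Real.mul_rpow ht.le (hu.1 i)]
    have h3 : gammaDensity (κ (Fin.last d)) (t * (1 - ∑ i, u i)) =
        Real.exp (-(t * (1 - ∑ i, u i))) *
          (t ^ κ (Fin.last d) * (1 - ∑ i, u i) ^ κ (Fin.last d)) := by
      rw [gammaDensity, Set.indicator_of_mem (Set.mem_Ici.2 (mul_nonneg ht.le h1)),
        Real.mul_rpow ht.le h1]
    have h4 : Real.exp (-t) =
        Real.exp (∑ i, -(t * u i)) * Real.exp (-(t * (1 - ∑ i, u i))) := by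
      rw [← Real.exp_add, Finset.sum_neg_distrib, ← Finset.mul_sum]
      congr 1
      ring
    simp only [h2, h3]
    rw [Set.indicator_of_mem hu, jacobiWeight, Finset.prod_mul_distrib, Finset.prod_mul_distrib,
      ← Real.exp_sum, h4, Fin.sum_univ_castSucc, Real.rpow_add ht,
      Real.rpow_sum_of_pos ht]
    ring
  · rw [Set.indicator_of_notMem hu, mul_zero, mul_eq_zero]
    rw [simplex, Set.mem_ofPred_eq, not_and_or] at hu
    rcases hu with hu | hu
    · push Not at hu
      obtain ⟨i, hi⟩ := hu
      refine Or.inl (Finset.prod_eq_zero (Finset.mem_univ i) (Set.indicator_of_notMem ?_ _))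
      exact not_le.2 (mul_neg_of_pos_of_neg ht hi)
    · refine Or.inr (Set.indicator_of_notMem ?_ _)
      exact not_le.2 (mul_neg_of_pos_of_neg ht (by linarith [not_le.1 hu]))

theorem lintegral_comp_const_smul {g : (Fin d → ℝ) → ENNReal} (hg : Measurable g) {t : ℝ}
    (ht : 0 < t) :
    ∫⁻ x, g x = ENNReal.ofReal (t ^ d) * ∫⁻ u, g (t • u) := by
  have h1 : ∫⁻ u, g (t • u) = ∫⁻ x, g x ∂(Measure.map (t • ·) volume) :=
    (lintegral_map hg (measurable_const_smul t)).symm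
  rw [h1, Measure.map_addHaar_smul volume ht.ne', lintegral_smul_measure, smul_eq_mul, ← mul_assoc,
    ← ENNReal.ofReal_mul (by positivity), Module.finrank_fin_fun, abs_of_pos (by positivity),
    mul_inv_cancel₀ (by positivity), ENNReal.ofReal_one, one_mul]

theorem gamma_prod_pos {κ : Fin (d + 1) → ℝ} (hκ : ∀ i, -1 < κ i) :
    0 < ∏ i, Real.Gamma (κ i + 1) :=
  Finset.prod_pos fun i _ => Real.Gamma_pos_of_pos (by linarith [hκ i])

/-- The Dirichlet integral. The integral of `y^κ exp (-|y|)` over the orthant is a product of Gamma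
functions; with `t = |y|` as last coordinate and after rescaling by `t` it is also `Γ(|κ| + d + 1)`
times the integral of the Jacobi weight. -/
theorem lintegral_jacobiWeight {κ : Fin (d + 1) → ℝ} (hκ : ∀ i, -1 < κ i) :
    ∫⁻ x in simplex d, ENNReal.ofReal (jacobiWeight κ x) =
      ENNReal.ofReal ((∏ i, Real.Gamma (κ i + 1)) / Real.Gamma (lam κ)) := by
  have hl := lam_pos hκ
  have hG := Real.Gamma_pos_of_pos hl
  set A : (Fin d → ℝ) → ℝ → ENNReal := fun x t =>
    ENNReal.ofReal (∏ i : Fin d, gammaDensity (κ i.castSucc) (x i)) *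
      ENNReal.ofReal (gammaDensity (κ (Fin.last d)) (t - ∑ i, x i)) with hA
  have hAm : Measurable (Function.uncurry A) := by
    have h1 : ∀ k, Measurable (gammaDensity k) := measurable_gammaDensity
    refine Measurable.mul (ENNReal.measurable_ofReal.comp ?_) (ENNReal.measurable_ofReal.comp ?_)
    · exact Finset.measurable_prod _ fun i _ =>
        (h1 _).comp ((measurable_pi_apply i).comp measurable_fst)
    · exact (h1 _).comp (by fun_prop)
  have e1 : ∫⁻ x, ∫⁻ t, A x t = ENNReal.ofReal (∏ i, Real.Gamma (κ i + 1)) := by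
    have h1 : ∀ x, ∫⁻ t, A x t =
        ENNReal.ofReal (∏ i : Fin d, gammaDensity (κ i.castSucc) (x i)) *
          ENNReal.ofReal (Real.Gamma (κ (Fin.last d) + 1)) := by
      intro x
      rw [lintegral_const_mul' _ _ ENNReal.ofReal_ne_top,
        lintegral_sub_right_eq_self fun t => ENNReal.ofReal (gammaDensity (κ (Fin.last d)) t),
        lintegral_gammaDensity (hκ _)]
    simp only [h1]
    rw [lintegral_mul_const' _ _ ENNReal.ofReal_ne_top,
      lintegral_prod_gammaDensity fun i => hκ i.castSucc, Fin.prod_univ_castSucc,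
      ENNReal.ofReal_mul]
    exact Finset.prod_nonneg fun i _ => (Real.Gamma_pos_of_pos (by linarith [hκ i.castSucc])).le
  set W := ∫⁻ x in simplex d, ENNReal.ofReal (jacobiWeight κ x) with hW
  have e2 : ∀ t, t ≠ 0 → ∫⁻ x, A x t =
      ENNReal.ofReal (gammaDensity (lam κ - 1) t) * W := by
    intro t ht
    rcases lt_or_gt_of_ne ht with ht | ht
    · have h0 : ∀ x, A x t = 0 := by
        intro x
        by_cases hx : ∀ i, 0 ≤ x i
        · have h1 : gammaDensity (κ (Fin.last d)) (t - ∑ i, x i) = 0 :=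
            Set.indicator_of_notMem (not_le.2
              (by linarith [Finset.sum_nonneg fun i (_ : i ∈ Finset.univ) => hx i])) _
          simp [hA, h1]
        · push Not at hx
          obtain ⟨i, hi⟩ := hx
          have h1 : ∏ i : Fin d, gammaDensity (κ i.castSucc) (x i) = 0 :=
            Finset.prod_eq_zero (Finset.mem_univ i) (Set.indicator_of_notMem (not_le.2 hi) _)
          simp [hA, h1]
      have h1 : gammaDensity (lam κ - 1) t = 0 := Set.indicator_of_notMem (not_le.2 ht) _
      simp [h0, h1]
    · have hm : Measurable fun x => A x t :=
        hAm.of_uncurry_right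
      refine (lintegral_comp_const_smul hm ht).trans ?_
      have h1 : ∀ u, A (t • u) t = ENNReal.ofReal (Real.exp (-t) * t ^ (∑ i, κ i)) *
          (simplex d).indicator (fun u => ENNReal.ofReal (jacobiWeight κ u)) u := by
        intro u
        simp only [hA, Pi.smul_apply, smul_eq_mul]
        rw [← ENNReal.ofReal_mul
          (Finset.prod_nonneg fun i _ => gammaDensity_nonneg _ _), prod_gammaDensity_smul κ ht,
          ENNReal.ofReal_mul (by positivity)]
        congr 1
        by_cases hu : u ∈ simplex d <;> simp [hu]
      have h2 : gammaDensity (lam κ - 1) t = t ^ d * (Real.exp (-t) * t ^ (∑ i, κ i)) := by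
        rw [gammaDensity, Set.indicator_of_mem (Set.mem_Ici.2 ht.le), lam,
          show ∑ i, κ i + d + 1 - 1 = ∑ i, κ i + d by ring, Real.rpow_add_natCast ht.ne']
        ring
      simp only [h1]
      rw [lintegral_const_mul' _ _ ENNReal.ofReal_ne_top,
        lintegral_indicator (measurableSet_simplex d), ← hW, ← mul_assoc,
        ← ENNReal.ofReal_mul (by positivity), ← h2]
  have e3 : ∫⁻ x, ∫⁻ t, A x t = ENNReal.ofReal (Real.Gamma (lam κ)) * W := by
    rw [lintegral_lintegral_swap hAm.aemeasurable]
    have hae : ∀ᵐ t : ℝ, t ≠ 0 := by simp [ae_iff, measure_singleton]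
    rw [lintegral_congr_ae (hae.mono fun t ht => e2 t ht), lintegral_mul_const _
      (measurable_gammaDensity _).ennreal_ofReal,
      lintegral_gammaDensity (by linarith), sub_add_cancel]
  rw [e1] at e3
  rw [ENNReal.ofReal_div_of_pos hG, e3, mul_comm,
    ENNReal.mul_div_cancel_right (by simpa using hG) ENNReal.ofReal_ne_top]

theorem integrableOn_jacobiWeight {κ : Fin (d + 1) → ℝ} (hκ : ∀ i, -1 < κ i) :
    IntegrableOn (jacobiWeight κ) (simplex d) := by
  refine ⟨(measurable_jacobiWeight κ).aestronglyMeasurable, ?_⟩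
  rw [hasFiniteIntegral_iff_ofReal ((ae_restrict_mem (measurableSet_simplex d)).mono
    fun x hx => jacobiWeight_nonneg κ hx), lintegral_jacobiWeight hκ]
  exact ENNReal.ofReal_lt_top

theorem integral_jacobiWeight {κ : Fin (d + 1) → ℝ} (hκ : ∀ i, -1 < κ i) :
    ∫ x in simplex d, jacobiWeight κ x =
      (∏ i, Real.Gamma (κ i + 1)) / Real.Gamma (lam κ) := by
  rw [integral_eq_lintegral_of_nonneg_ae ((ae_restrict_mem (measurableSet_simplex d)).mono
    fun x hx => jacobiWeight_nonneg κ hx) (measurable_jacobiWeight κ).aestronglyMeasurable,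
    lintegral_jacobiWeight hκ, ENNReal.toReal_ofReal]
  exact div_nonneg (gamma_prod_pos hκ).le (Real.Gamma_pos_of_pos (lam_pos hκ)).le

end Dirichlet

/-! ### Orthogonal polynomials on the simplex -/

section Simplex

variable {d : ℕ}

theorem gamma_add_nat {c : ℝ} (hc : 0 < c) (k : ℕ) :
    Real.Gamma (c + k) = poch c k * Real.Gamma c := by
  induction k with
  | zero => simp [poch]
  | succ k ih =>
    rw [Nat.cast_succ, ← add_assoc, Real.Gamma_add_one (by positivity), ih, poch_succ]
    ring

/-- Restriction of polynomials in `y_1, …, y_{d+1}` to the hyperplane `|y| = 1`, on which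
`y = (x, 1 - |x|)`. -/
def dehom (d : ℕ) : MvPolynomial (Fin (d + 1)) ℝ →ₐ[ℝ] MvPolynomial (Fin d) ℝ :=
  aeval (Fin.snoc (α := fun _ => MvPolynomial (Fin d) ℝ) X (1 - ∑ i, X i))

theorem dehom_X_castSucc (i : Fin d) : dehom d (X i.castSucc) = X i := by
  rw [dehom, aeval_X, Fin.snoc_castSucc]

theorem dehom_X_last : dehom d (X (Fin.last d)) = 1 - ∑ i, X i := by
  rw [dehom, aeval_X, Fin.snoc_last]

theorem dehom_rename (p : MvPolynomial (Fin d) ℝ) :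
    dehom d (rename Fin.castSucc p) = p := by
  have h : (dehom d).comp (rename Fin.castSucc) = AlgHom.id ℝ (MvPolynomial (Fin d) ℝ) :=
    MvPolynomial.algHom_ext fun i => by simp [dehom_X_castSucc]
  simpa using congrArg (fun f => f p) h

theorem dehom_monomial (α : Fin (d + 1) →₀ ℕ) (c : ℝ) :
    dehom d (monomial α c) = c • homMonomial α := by
  rw [monomial_eq, Finsupp.prod_fintype _ _ (fun i => pow_zero _), map_mul, map_prod,
    Fin.prod_univ_castSucc, homMonomial, smul_eq_C_mul]
  simp only [map_pow, dehom_X_castSucc, dehom_X_last]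
  rw [← algebraMap_eq, AlgHom.commutes, algebraMap_eq]

theorem dehom_linForm_univ : dehom d (linForm Finset.univ) = 1 := by
  rw [linForm, map_sum, Fin.sum_univ_castSucc]
  simp only [dehom_X_castSucc, dehom_X_last]
  ring

theorem dehom_hahnGen (κ : Fin (d + 1) → ℝ) (ν : Fin d → ℕ) (N : ℕ) :
    dehom d (hahnGen κ ν N) = jacobiP κ ν := by
  have hu : ∀ j : Fin d, dehom d (∑ i with j.castSucc < i, X i) = 1 - ∑ i with i ≤ j, X i := by
    intro j
    rw [map_sum, eq_sub_iff_add_eq, Finset.sum_filter, Finset.sum_filter, Fin.sum_univ_castSucc]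
    simp only [dehom_X_castSucc, dehom_X_last, Fin.castSucc_lt_castSucc_iff, Fin.castSucc_lt_last,
      if_true]
    rw [add_right_comm, ← Finset.sum_add_distrib]
    have : ∀ i : Fin d, ((if j < i then X i else 0) + (if i ≤ j then X i else 0) :
        MvPolynomial (Fin d) ℝ) = X i := by
      intro i
      by_cases h : j < i
      · simp [h]
      · simp [h, not_lt.1 h]
    simp [this]
  have hv : ∀ j : Fin d, dehom d (∑ i with j.castSucc ≤ i, X i) = 1 - ∑ i with i < j, X i := by
    intro j
    rw [map_sum, eq_sub_iff_add_eq, Finset.sum_filter, Finset.sum_filter, Fin.sum_univ_castSucc]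
    simp only [dehom_X_castSucc, dehom_X_last, Fin.castSucc_le_castSucc_iff, Fin.le_last,
      if_true]
    rw [add_right_comm, ← Finset.sum_add_distrib]
    have : ∀ i : Fin d, ((if j ≤ i then X i else 0) + (if i < j then X i else 0) :
        MvPolynomial (Fin d) ℝ) = X i := by
      intro i
      by_cases h : j ≤ i
      · simp [h]
      · simp [h, not_le.1 h]
    simp [this]
  have hs : dehom d (∑ i, X i) = 1 := dehom_linForm_univ
  rw [hahnGen, map_mul, map_pow, hs, one_pow, one_mul, map_prod, jacobiP]
  refine Finset.prod_congr rfl fun j _ => ?_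
  rw [map_jacobiHom, hu, hv]

theorem eval_homMonomial_mul_jacobiWeight {κ : Fin (d + 1) → ℝ} (hκ : ∀ i, -1 < κ i)
    (α : Fin (d + 1) → ℕ) {x : Fin d → ℝ} (hx : x ∈ simplex d) :
    eval x (homMonomial α) * jacobiWeight κ x = jacobiWeight (fun i => κ i + α i) x := by
  -- At `r = 0` the identity needs that `k + m > 0` unless `m = 0`.
  have h : ∀ (r k : ℝ) (m : ℕ), 0 ≤ r → -1 < k → r ^ m * r ^ k = r ^ (k + m) := by
    intro r k m hr hk
    rcases Nat.eq_zero_or_pos m with rfl | hm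
    · simp
    · have : (1 : ℝ) ≤ m := by exact_mod_cast hm
      rw [Real.rpow_add' hr (by linarith), Real.rpow_natCast, mul_comm]
  have h1 := h (1 - ∑ i, x i) _ (α (Fin.last d)) (sub_nonneg.2 hx.2) (hκ (Fin.last d))
  rw [homMonomial, jacobiWeight, jacobiWeight, ← h1,
    ← Finset.prod_congr rfl fun i _ => h (x i) _ (α i.castSucc) (hx.1 i) (hκ i.castSucc),
    Finset.prod_mul_distrib]
  simp only [map_mul, map_prod, map_pow, map_sub, map_sum, map_one, eval_X]
  ring

/-- The integrand of the inner product is integrable. -/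
theorem integrableOn_eval_mul_jacobiWeight {κ : Fin (d + 1) → ℝ} (hκ : ∀ i, -1 < κ i)
    (p : MvPolynomial (Fin d) ℝ) :
    IntegrableOn (fun x => eval x p * jacobiWeight κ x) (simplex d) := by
  rw [← dehom_rename p]
  induction rename Fin.castSucc p using MvPolynomial.induction_on' with
  | add p q hp hq =>
    simp only [map_add, add_mul]
    exact hp.add hq
  | monomial α c =>
    have h := (integrableOn_jacobiWeight (κ := fun i => κ i + α i) fun i => by
      have := hκ i; have : (0 : ℝ) ≤ α i := Nat.cast_nonneg _; linarith).const_mul c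
    refine IntegrableOn.congr_fun h (fun x hx => ?_) (measurableSet_simplex d)
    simp only [dehom_monomial, smul_eval, mul_assoc, eval_homMonomial_mul_jacobiWeight hκ _ hx]

/-- The normalized integral of a polynomial against the Jacobi weight. -/
def jacobiIntegral (κ : Fin (d + 1) → ℝ) (p : MvPolynomial (Fin d) ℝ) : ℝ :=
  Real.Gamma (lam κ) / (∏ i, Real.Gamma (κ i + 1)) *
    ∫ x in simplex d, eval x p * jacobiWeight κ x

theorem jacobiInner_eq (κ : Fin (d + 1) → ℝ) (f g : MvPolynomial (Fin d) ℝ) :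
    jacobiInner κ f g = jacobiIntegral κ (f * g) := by
  simp [jacobiInner, jacobiIntegral]

theorem jacobiIntegral_add {κ : Fin (d + 1) → ℝ} (hκ : ∀ i, -1 < κ i)
    (p q : MvPolynomial (Fin d) ℝ) :
    jacobiIntegral κ (p + q) = jacobiIntegral κ p + jacobiIntegral κ q := by
  simp only [jacobiIntegral, map_add, add_mul]
  rw [integral_add (integrableOn_eval_mul_jacobiWeight hκ p)
    (integrableOn_eval_mul_jacobiWeight hκ q), mul_add]

theorem jacobiIntegral_smul (κ : Fin (d + 1) → ℝ) (c : ℝ) (p : MvPolynomial (Fin d) ℝ) :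
    jacobiIntegral κ (c • p) = c * jacobiIntegral κ p := by
  simp only [jacobiIntegral, smul_eval, mul_assoc]
  rw [integral_const_mul]
  ring

theorem jacobiIntegral_sum {κ : Fin (d + 1) → ℝ} (hκ : ∀ i, -1 < κ i) {ι : Type*}
    (s : Finset ι) (p : ι → MvPolynomial (Fin d) ℝ) :
    jacobiIntegral κ (∑ i ∈ s, p i) = ∑ i ∈ s, jacobiIntegral κ (p i) := by
  induction s using Finset.cons_induction with
  | empty => simp [jacobiIntegral]
  | cons a s ha ih => rw [Finset.sum_cons, Finset.sum_cons, jacobiIntegral_add hκ, ih]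

theorem jacobiIntegral_homMonomial {κ : Fin (d + 1) → ℝ} (hκ : ∀ i, -1 < κ i)
    (α : Fin (d + 1) → ℕ) :
    jacobiIntegral κ (homMonomial α) = pochSucc κ α / poch (lam κ) (∑ i, α i) := by
  have hκ' : ∀ i, -1 < κ i + α i := fun i => by
    have := hκ i; have : (0 : ℝ) ≤ α i := Nat.cast_nonneg _; linarith
  have hl : lam (fun i => κ i + α i) = lam κ + (∑ i, α i : ℕ) := by
    simp only [lam, Finset.sum_add_distrib]
    push_cast
    ring
  have hg : ∏ i, Real.Gamma (κ i + α i + 1) = pochSucc κ α * ∏ i, Real.Gamma (κ i + 1) := by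
    rw [pochSucc, ← Finset.prod_mul_distrib]
    refine Finset.prod_congr rfl fun i _ => ?_
    rw [add_right_comm, gamma_add_nat (by linarith [hκ i])]
  have h1 := (gamma_prod_pos hκ).ne'
  have h2 := (Real.Gamma_pos_of_pos (lam_pos hκ)).ne'
  have h3 := (poch_pos (lam_pos hκ) (∑ i, α i)).ne'
  rw [jacobiIntegral, setIntegral_congr_fun (measurableSet_simplex d)
    (fun x hx => eval_homMonomial_mul_jacobiWeight hκ α hx), integral_jacobiWeight hκ', hl, hg,
    gamma_add_nat (lam_pos hκ)]
  field_simp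

/-- On homogeneous polynomials, integration over the simplex is a multiple of `moment`. -/
theorem jacobiIntegral_dehom {κ : Fin (d + 1) → ℝ} (hκ : ∀ i, -1 < κ i)
    {q : MvPolynomial (Fin (d + 1)) ℝ} {N : ℕ} (hq : q.IsHomogeneous N) :
    jacobiIntegral κ (dehom d q) = moment κ q / poch (lam κ) N := by
  conv_lhs => rw [q.as_sum]
  conv_rhs => rw [q.as_sum]
  rw [map_sum, map_sum, jacobiIntegral_sum hκ, Finset.sum_div]
  refine Finset.sum_congr rfl fun α hα => ?_
  have h : ∑ i, α i = N := by
    have := hq (mem_support_iff.1 hα)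
    simpa [Finsupp.weight_apply, Finsupp.sum_fintype] using this
  rw [dehom_monomial, jacobiIntegral_smul, jacobiIntegral_homMonomial hκ, moment_monomial, h,
    mul_div_assoc]

/-- The restriction of a harmonic polynomial of degree `n` is orthogonal to all polynomials of
smaller degree. -/
theorem jacobiInner_dehom_harmonic {κ : Fin (d + 1) → ℝ} (hκ : ∀ i, -1 < κ i)
    {p : MvPolynomial (Fin (d + 1)) ℝ} {n : ℕ} (hp : p.IsHomogeneous n)
    (hb : bessel κ Finset.univ p = 0) {Q : MvPolynomial (Fin d) ℝ} (hQ : Q ∈ polyDegLT d n) :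
    jacobiInner κ (dehom d p) Q = 0 := by
  rw [jacobiInner_eq, ← dehom_rename Q, ← map_mul]
  conv_lhs => rw [Q.as_sum]
  rw [map_sum, Finset.mul_sum, map_sum, jacobiIntegral_sum hκ]
  refine Finset.sum_eq_zero fun m hm => ?_
  have hm' : m.degree < n := hQ hm
  have hq : (rename Fin.castSucc (monomial m (coeff m Q)) :
      MvPolynomial (Fin (d + 1)) ℝ).IsHomogeneous m.degree :=
    (isHomogeneous_monomial _ rfl).rename_isHomogeneous
  rw [jacobiIntegral_dehom hκ (hp.mul hq), moment_harmonic_mul κ p hp hb _ hm' _ hq, zero_div]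

/-- The inner product is positive definite. -/
theorem eq_zero_of_jacobiInner_self {κ : Fin (d + 1) → ℝ} (hκ : ∀ i, -1 < κ i)
    (p : MvPolynomial (Fin d) ℝ) (h : jacobiInner κ p p = 0) : p = 0 := by
  have hc : Real.Gamma (lam κ) / (∏ i, Real.Gamma (κ i + 1)) ≠ 0 :=
    (div_pos (Real.Gamma_pos_of_pos (lam_pos hκ)) (gamma_prod_pos hκ)).ne'
  have hint : ∫ x in simplex d, eval x (p * p) * jacobiWeight κ x = 0 := by
    rw [jacobiInner_eq, jacobiIntegral] at h
    exact (mul_eq_zero.1 h).resolve_left hc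
  rw [setIntegral_eq_zero_iff_of_nonneg_ae ((ae_restrict_mem (measurableSet_simplex d)).mono
    fun x hx => by
      rw [map_mul]
      exact mul_nonneg (mul_self_nonneg _) (jacobiWeight_nonneg κ hx))
    (integrableOn_eval_mul_jacobiWeight hκ _)] at hint
  -- The weight is positive on an open cube inside the simplex, so `p` vanishes on that cube.
  set U : Set (Fin d → ℝ) := Set.pi Set.univ fun _ => Set.Ioo (0 : ℝ) (1 / (d + 1)) with hU
  have hsum : ∀ x ∈ U, ∑ i, x i < 1 := by
    intro x hx
    have h1 : ∑ i, x i ≤ ∑ _i : Fin d, (1 / (d + 1) : ℝ) :=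
      Finset.sum_le_sum fun i _ => (hx i trivial).2.le
    rw [Finset.sum_const, Finset.card_univ, Fintype.card_fin, nsmul_eq_mul, mul_one_div] at h1
    exact h1.trans_lt ((div_lt_one (by positivity)).2 (by linarith))
  have hsub : U ⊆ simplex d := fun x hx => ⟨fun i => (hx i trivial).1.le, (hsum x hx).le⟩
  have hopen : IsOpen U := isOpen_set_pi Set.finite_univ fun _ _ => isOpen_Ioo
  have hae : (fun x => eval x p) =ᵐ[volume.restrict U] fun _ => (0 : ℝ) := by
    filter_upwards [ae_restrict_of_ae_restrict_of_subset hsub hint,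
      ae_restrict_mem hopen.measurableSet] with x hx hxU
    have hw : 0 < jacobiWeight κ x :=
      mul_pos (Finset.prod_pos fun i _ => Real.rpow_pos_of_pos (hxU i trivial).1 _)
        (Real.rpow_pos_of_pos (sub_pos.2 (hsum x hxU)) _)
    have := (mul_eq_zero.1 hx).resolve_right hw.ne'
    rw [map_mul] at this
    exact mul_self_eq_zero.1 this
  have heq := Measure.eqOn_open_of_ae_eq hae hopen
    (MvPolynomial.continuous_eval p).continuousOn continuousOn_const
  refine MvPolynomial.funext_set (fun _ : Fin d => Set.Ioo (0 : ℝ) (1 / (d + 1)))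
    (fun _ => Set.Ioo_infinite (by positivity)) fun x hx => ?_
  rw [map_zero]
  exact heq hx

end Simplex

/-! ### The connecting coefficients -/

section Connection

variable {d : ℕ}

theorem piAntidiag_init_le {n : ℕ} {β : Fin (d + 1) → ℕ} (hβ : ∑ i, β i = n) :
    ∑ j, Fin.init β j ≤ n := by
  rw [← hβ, Fin.sum_univ_castSucc]
  exact Nat.le_add_right _ _

theorem eq_of_init_eq {n : ℕ} {β γ : Fin (d + 1) → ℕ} (hβ : ∑ i, β i = n) (hγ : ∑ i, γ i = n)
    (h : Fin.init β = Fin.init γ) : β = γ := by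
  rw [Fin.sum_univ_castSucc] at hβ hγ
  have h1 : ∀ i : Fin d, β i.castSucc = γ i.castSucc := fun i => congrFun h i
  simp only [h1] at hβ
  funext i
  refine Fin.lastCases ?_ h1 i
  omega

theorem mem_piAntidiag_univ {m n : ℕ} {β : Fin m → ℕ} :
    β ∈ Finset.univ.piAntidiag n ↔ ∑ i, β i = n := by
  simp [Finset.mem_piAntidiag]

/-- The Hahn polynomials of degree at most `n` form an orthogonal basis of the functions on
`{α : |α| = n}`, which yields the dual orthogonality relation. The indices `μ` with `|μ| ≤ n` are
written as `(β_1, …, β_d)` with `|β| = n`, so that the matrix of the `H_μ(α)` is square. -/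
theorem hahn_dual_orthogonality {κ : Fin (d + 1) → ℝ} (hκ : ∀ i, -1 < κ i) (n : ℕ)
    {α γ : Fin (d + 1) → ℕ} (hα : ∑ i, α i = n) (hγ : ∑ i, γ i = n) :
    n.factorial / poch (lam κ) n * (pochSucc κ α / multiFact α) *
      ∑ β ∈ Finset.univ.piAntidiag n, hahn κ n (Fin.init β) α * hahn κ n (Fin.init β) γ /
        hahnNormSq κ n (Fin.init β) = if γ = α then 1 else 0 := by
  set A := (Finset.univ.piAntidiag n : Finset (Fin (d + 1) → ℕ)) with hA
  have hmem : ∀ β : A, ∑ i, (β : Fin (d + 1) → ℕ) i = n := fun β => mem_piAntidiag_univ.1 β.2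
  let M : Matrix A A ℝ := fun γ β => hahn κ n (Fin.init (β : Fin (d + 1) → ℕ)) γ
  let M' : Matrix A A ℝ := fun β α => (hahnNormSq κ n (Fin.init (β : Fin (d + 1) → ℕ)))⁻¹ *
    (n.factorial / poch (lam κ) n * (pochSucc κ α / multiFact (α : Fin (d + 1) → ℕ)) *
      hahn κ n (Fin.init (β : Fin (d + 1) → ℕ)) α)
  have h1 : M' * M = 1 := by
    ext β β'
    have e : (M' * M) β β' = (hahnNormSq κ n (Fin.init (β : Fin (d + 1) → ℕ)))⁻¹ *
        hahnInner κ n (hahn κ n (Fin.init (β : Fin (d + 1) → ℕ)))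
          (hahn κ n (Fin.init (β' : Fin (d + 1) → ℕ))) := by
      rw [Matrix.mul_apply, hahnInner, Finset.mul_sum, Finset.mul_sum, ← hA,
        ← Finset.sum_coe_sort A]
      refine Finset.sum_congr rfl fun α _ => ?_
      simp only [M, M']
      ring
    rw [e, Matrix.one_apply]
    split_ifs with h
    · subst h
      exact inv_mul_cancel₀ (hahnNormSq_pos hκ _ n (piAntidiag_init_le (hmem β))).ne'
    · rw [hahnInner_eq_zero hκ _ n (piAntidiag_init_le (hmem β)), mul_zero]
      exact fun h' => h (Subtype.ext (eq_of_init_eq (hmem β) (hmem β') h'))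
  have h2 : (M * M') ⟨γ, mem_piAntidiag_univ.2 hγ⟩ ⟨α, mem_piAntidiag_univ.2 hα⟩ =
      (1 : Matrix A A ℝ) ⟨γ, mem_piAntidiag_univ.2 hγ⟩ ⟨α, mem_piAntidiag_univ.2 hα⟩ := by
    rw [mul_eq_one_comm.1 h1]
  rw [Matrix.mul_apply, Matrix.one_apply, Finset.sum_coe_sort A (fun β =>
    hahn κ n (Fin.init β) γ * ((hahnNormSq κ n (Fin.init β))⁻¹ *
      (n.factorial / poch (lam κ) n * (pochSucc κ α / multiFact α) *
        hahn κ n (Fin.init β) α)))] at h2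
  simp only [Subtype.mk.injEq] at h2
  rw [← h2, Finset.mul_sum]
  refine Finset.sum_congr rfl fun β _ => ?_
  rw [div_eq_mul_inv (_ * _) (hahnNormSq _ _ _)]
  ring

theorem jacobiP_eq_sum_homMonomial (κ : Fin (d + 1) → ℝ) (ν : Fin d → ℕ) {N : ℕ}
    (hν : ∑ j, ν j ≤ N) :
    jacobiP κ ν = ∑ α ∈ Finset.univ.piAntidiag N,
      (N.factorial / multiFact α * hahn κ N ν α) • homMonomial α := by
  rw [← dehom_hahnGen κ ν N]
  conv_lhs => rw [(hahnGen κ ν N).as_sum]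
  rw [map_sum, sum_support_eq_sum_piAntidiag (isHomogeneous_hahnGen κ ν N hν) _
    (fun α h => by rw [h]; simp)]
  refine Finset.sum_congr rfl fun α _ => ?_
  rw [dehom_monomial, coeff_hahnGen, Finsupp.coe_equivFunOnFinite_symm]

/-- The expansion of `X^α` in the polynomials `P_μ` with `|μ| ≤ |α|`. -/
theorem homMonomial_eq_sum_jacobiP {κ : Fin (d + 1) → ℝ} (hκ : ∀ i, -1 < κ i) {n : ℕ}
    {α : Fin (d + 1) → ℕ} (hα : ∑ i, α i = n) :
    homMonomial α = (pochSucc κ α / poch (lam κ) n) • ∑ β ∈ Finset.univ.piAntidiag n,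
      (hahn κ n (Fin.init β) α / hahnNormSq κ n (Fin.init β)) • jacobiP κ (Fin.init β) := by
  have h1 : ∀ β ∈ (Finset.univ.piAntidiag n : Finset (Fin (d + 1) → ℕ)),
      (hahn κ n (Fin.init β) α / hahnNormSq κ n (Fin.init β)) • jacobiP κ (Fin.init β) =
      ∑ γ ∈ Finset.univ.piAntidiag n,
        (n.factorial / multiFact γ * (hahn κ n (Fin.init β) α * hahn κ n (Fin.init β) γ /
          hahnNormSq κ n (Fin.init β))) • homMonomial γ := by
    intro β hβ
    rw [jacobiP_eq_sum_homMonomial κ _ (piAntidiag_init_le (mem_piAntidiag_univ.1 hβ)),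
      Finset.smul_sum]
    refine Finset.sum_congr rfl fun γ _ => ?_
    rw [smul_smul]
    congr 1
    ring
  rw [Finset.sum_congr rfl h1, Finset.sum_comm, Finset.smul_sum]
  have h2 : ∀ γ ∈ (Finset.univ.piAntidiag n : Finset (Fin (d + 1) → ℕ)),
      (pochSucc κ α / poch (lam κ) n) • ∑ β ∈ Finset.univ.piAntidiag n,
        (n.factorial / multiFact γ * (hahn κ n (Fin.init β) α * hahn κ n (Fin.init β) γ /
          hahnNormSq κ n (Fin.init β))) • homMonomial γ =
      if γ = α then homMonomial γ else 0 := by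
    intro γ hγ
    have h3 := hahn_dual_orthogonality hκ n hα (mem_piAntidiag_univ.1 hγ)
    have hf : (n.factorial : ℝ) ≠ 0 := by positivity
    have hα0 := (multiFact_pos α).ne'
    have hγ0 := (multiFact_pos γ).ne'
    rw [← Finset.sum_smul, ← Finset.mul_sum, smul_smul]
    have h4 : pochSucc κ α / poch (lam κ) n * (n.factorial / multiFact γ *
        ∑ β ∈ Finset.univ.piAntidiag n, hahn κ n (Fin.init β) α * hahn κ n (Fin.init β) γ /
          hahnNormSq κ n (Fin.init β)) =
        multiFact α / multiFact γ * if γ = α then 1 else 0 := by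
      rw [← h3]
      field_simp
    rw [h4]
    split_ifs with h
    · subst h
      rw [div_self hγ0, one_mul, one_smul]
    · rw [mul_zero, zero_smul]
  rw [Finset.sum_congr rfl h2, Finset.sum_ite_eq', if_pos (mem_piAntidiag_univ.2 hα)]

theorem totalDegree_homMonomial_le (α : Fin (d + 1) → ℕ) :
    (homMonomial α : MvPolynomial (Fin d) ℝ).totalDegree ≤ ∑ i, α i := by
  have hl : (1 - ∑ i : Fin d, X i : MvPolynomial (Fin d) ℝ).totalDegree ≤ 1 := by
    refine (totalDegree_sub _ _).trans (max_le (by simp) ?_)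
    exact totalDegree_finsetSum_le fun i _ => (totalDegree_X (R := ℝ) i).le
  rw [homMonomial, Fin.sum_univ_castSucc]
  refine (totalDegree_mul _ _).trans (add_le_add ?_ ?_)
  · refine (totalDegree_finsetProd _ _).trans (Finset.sum_le_sum fun i _ => ?_)
    exact (totalDegree_X_pow (R := ℝ) i _).le
  · exact (totalDegree_pow _ _).trans (by nlinarith)

theorem totalDegree_jacobiP_le (κ : Fin (d + 1) → ℝ) (ν : Fin d → ℕ) :
    (jacobiP κ ν).totalDegree ≤ ∑ j, ν j := by
  rw [jacobiP_eq_sum_homMonomial κ ν le_rfl]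
  refine totalDegree_finsetSum_le fun α hα => (totalDegree_smul_le _ _).trans ?_
  exact (totalDegree_homMonomial_le α).trans (mem_piAntidiag_univ.1 hα).le

theorem mem_polyDegLT_of_totalDegree_lt {p : MvPolynomial (Fin d) ℝ} {n : ℕ}
    (h : p.totalDegree < n) : p ∈ polyDegLT d n := by
  intro m hm
  exact (le_totalDegree hm : m.degree ≤ p.totalDegree).trans_lt h

/-- The orthogonal polynomials of degree `n`, as a subspace. -/
def orthogonalSpace {κ : Fin (d + 1) → ℝ} (hκ : ∀ i, -1 < κ i) (n : ℕ) :
    Submodule ℝ (MvPolynomial (Fin d) ℝ) where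
  carrier := {P | IsOrthogonalPoly κ n P}
  zero_mem' := ⟨by simp, fun Q _ => by simp [jacobiInner]⟩
  add_mem' := by
    intro P P' h h'
    refine ⟨(totalDegree_add _ _).trans (max_le h.1 h'.1), fun Q hQ => ?_⟩
    have h1 := h.2 Q hQ
    have h2 := h'.2 Q hQ
    rw [jacobiInner_eq] at h1 h2 ⊢
    rw [add_mul, jacobiIntegral_add hκ, h1, h2, add_zero]
  smul_mem' := by
    intro c P h
    refine ⟨(totalDegree_smul_le _ _).trans h.1, fun Q hQ => ?_⟩
    have h1 := h.2 Q hQ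
    rw [jacobiInner_eq] at h1 ⊢
    rw [smul_mul_assoc, jacobiIntegral_smul, h1, mul_zero]

theorem eq_of_sub_mem_polyDegLT {κ : Fin (d + 1) → ℝ} (hκ : ∀ i, -1 < κ i) {n : ℕ}
    {P P' : MvPolynomial (Fin d) ℝ} (h : P ∈ orthogonalSpace hκ n)
    (h' : P' ∈ orthogonalSpace hκ n) (hs : P - P' ∈ polyDegLT d n) : P = P' :=
  sub_eq_zero.1 (eq_zero_of_jacobiInner_self hκ _
    (((orthogonalSpace hκ n).sub_mem h h').2 _ hs))

theorem jacobiP_mem_orthogonalSpace {κ : Fin (d + 1) → ℝ} (hκ : ∀ i, -1 < κ i) {n : ℕ}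
    {ν : Fin d → ℕ} (hν : ∑ j, ν j = n) : jacobiP κ ν ∈ orthogonalSpace hκ n := by
  subst hν
  refine ⟨totalDegree_jacobiP_le κ ν, fun Q hQ => ?_⟩
  rw [← dehom_hahnGen κ ν (∑ j, ν j)]
  exact jacobiInner_dehom_harmonic hκ (isHomogeneous_hahnGen κ ν _ le_rfl)
    (bessel_hahnGen hκ ν) hQ

/-- The combination of Jacobi polynomials that turns out to be the monic polynomial `R_α`. -/
def jacobiExpansion (κ : Fin (d + 1) → ℝ) (n : ℕ) (α : Fin (d + 1) → ℕ) :
    MvPolynomial (Fin d) ℝ :=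
  (pochSucc κ α / poch (lam κ) n) • ∑ ν ∈ Finset.univ.piAntidiag n,
    (hahn κ n ν α / hahnNormSq κ n ν) • jacobiP κ ν

theorem homMonomial_sub_jacobiExpansion_mem {κ : Fin (d + 1) → ℝ} (hκ : ∀ i, -1 < κ i) {n : ℕ}
    {α : Fin (d + 1) → ℕ} (hα : ∑ i, α i = n) :
    homMonomial α - jacobiExpansion κ n α ∈ polyDegLT d n := by
  set f : (Fin d → ℕ) → MvPolynomial (Fin d) ℝ := fun ν =>
    (hahn κ n ν α / hahnNormSq κ n ν) • jacobiP κ ν with hf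
  set A := (Finset.univ.piAntidiag n : Finset (Fin (d + 1) → ℕ)) with hA
  have htop : ∑ β ∈ A with β (Fin.last d) = 0, f (Fin.init β) =
      ∑ ν ∈ Finset.univ.piAntidiag n, f ν := by
    refine Finset.sum_bij' (fun β _ => Fin.init β)
      (fun ν _ => Fin.snoc (α := fun _ => ℕ) ν 0) ?_ ?_ ?_ ?_ ?_
    · intro β hβ
      obtain ⟨h1, h2⟩ := Finset.mem_filter.1 hβ
      have h3 := mem_piAntidiag_univ.1 h1
      rw [Fin.sum_univ_castSucc, h2, add_zero] at h3
      exact mem_piAntidiag_univ.2 h3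
    · intro ν hν
      refine Finset.mem_filter.2 ⟨mem_piAntidiag_univ.2 ?_, by simp⟩
      rw [Fin.sum_univ_castSucc]
      simpa using mem_piAntidiag_univ.1 hν
    · intro β hβ
      have h2 := (Finset.mem_filter.1 hβ).2
      simp only [← h2, Fin.snoc_init_self]
    · intro ν _
      exact Fin.init_snoc (α := fun _ => ℕ) _ _
    · intro β _
      rfl
  rw [homMonomial_eq_sum_jacobiP hκ hα, jacobiExpansion, ← smul_sub, ← hf, ← htop, ← hA,
    ← Finset.sum_filter_add_sum_filter_not A (fun β => β (Fin.last d) = 0), add_sub_cancel_left]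
  refine Submodule.smul_mem _ _ (Submodule.sum_mem _ fun β hβ => Submodule.smul_mem _ _ ?_)
  obtain ⟨h1, h2⟩ := Finset.mem_filter.1 hβ
  have h3 := mem_piAntidiag_univ.1 h1
  rw [Fin.sum_univ_castSucc] at h3
  refine mem_polyDegLT_of_totalDegree_lt ((totalDegree_jacobiP_le κ _).trans_lt ?_)
  simp only [Fin.init]
  omega

theorem jacobiExpansion_mem_orthogonalSpace {κ : Fin (d + 1) → ℝ} (hκ : ∀ i, -1 < κ i) (n : ℕ)
    (α : Fin (d + 1) → ℕ) : jacobiExpansion κ n α ∈ orthogonalSpace hκ n :=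
  Submodule.smul_mem _ _ (Submodule.sum_mem _ fun _ hν => Submodule.smul_mem _ _
    (jacobiP_mem_orthogonalSpace hκ (mem_piAntidiag_univ.1 hν)))

theorem isMonicOrthogonal_jacobiExpansion {κ : Fin (d + 1) → ℝ} (hκ : ∀ i, -1 < κ i) {n : ℕ}
    {α : Fin (d + 1) → ℕ} (hα : ∑ i, α i = n) :
    IsMonicOrthogonal κ α (jacobiExpansion κ n α) := by
  subst hα
  refine ⟨jacobiExpansion_mem_orthogonalSpace hκ _ α, jacobiExpansion κ _ α - homMonomial α, ?_,
    by ring⟩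
  rw [← neg_sub]
  exact Submodule.neg_mem _ (homMonomial_sub_jacobiExpansion_mem hκ rfl)

theorem IsMonicOrthogonal.unique {κ : Fin (d + 1) → ℝ} (hκ : ∀ i, -1 < κ i)
    {α : Fin (d + 1) → ℕ} {R R' : MvPolynomial (Fin d) ℝ} (h : IsMonicOrthogonal κ α R)
    (h' : IsMonicOrthogonal κ α R') : R = R' := by
  obtain ⟨h1, q, hq, rfl⟩ := h
  obtain ⟨h1', q', hq', rfl⟩ := h'
  refine eq_of_sub_mem_polyDegLT hκ h1 h1' ?_
  rw [add_sub_add_left_eq_sub]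
  exact Submodule.sub_mem _ hq hq'

theorem isMonicOrthogonal_monicR {κ : Fin (d + 1) → ℝ} (hκ : ∀ i, -1 < κ i)
    (α : Fin (d + 1) → ℕ) : IsMonicOrthogonal κ α (monicR κ α) :=
  Classical.epsilon_spec (p := IsMonicOrthogonal κ α) ⟨_, isMonicOrthogonal_jacobiExpansion hκ rfl⟩

theorem jacobiP_eq_sum_monicR {κ : Fin (d + 1) → ℝ} (hκ : ∀ i, -1 < κ i) {n : ℕ}
    {ν : Fin d → ℕ} (hν : ∑ j, ν j = n) :
    jacobiP κ ν = ∑ α ∈ Finset.univ.piAntidiag n,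
      (n.factorial / multiFact α * hahn κ n ν α) • monicR κ α := by
  refine eq_of_sub_mem_polyDegLT hκ (jacobiP_mem_orthogonalSpace hκ hν)
    (Submodule.sum_mem _ fun α hα => Submodule.smul_mem _ _ ?_) ?_
  · have h := (isMonicOrthogonal_monicR hκ α).1
    rw [mem_piAntidiag_univ.1 hα] at h
    exact h
  · rw [jacobiP_eq_sum_homMonomial κ ν hν.le, ← Finset.sum_sub_distrib]
    refine Submodule.sum_mem _ fun α hα => ?_
    rw [← smul_sub]
    refine Submodule.smul_mem _ _ ?_
    obtain ⟨_, q, hq, hR⟩ := isMonicOrthogonal_monicR hκ α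
    rw [hR, sub_add_cancel_left, ← mem_piAntidiag_univ.1 hα]
    exact Submodule.neg_mem _ hq

end Connection

end SimplexPoly

end

theorem mainTheorem5 (d : ℕ) (hd : 1 ≤ d) (κ : Fin (d + 1) → ℝ) (hκ : ∀ i, -1 < κ i) (n : ℕ) :
    (∀ α : Fin (d + 1) → ℕ, ∑ i, α i = n →
      SimplexPoly.IsMonicOrthogonal κ α (SimplexPoly.monicR κ α) ∧
        ∀ R, SimplexPoly.IsMonicOrthogonal κ α R → R = SimplexPoly.monicR κ α) ∧
    (∀ ν : Fin d → ℕ, ∑ j, ν j = n →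
      SimplexPoly.jacobiP κ ν = ∑ α ∈ Finset.univ.piAntidiag n,
        (n.factorial / SimplexPoly.multiFact α * SimplexPoly.hahn κ n ν α) •
          SimplexPoly.monicR κ α) ∧
    (∀ α : Fin (d + 1) → ℕ, ∑ i, α i = n →
      SimplexPoly.monicR κ α =
        (SimplexPoly.pochSucc κ α / SimplexPoly.poch (SimplexPoly.lam κ) n) •
          ∑ ν ∈ Finset.univ.piAntidiag n,
            (SimplexPoly.hahn κ n ν α / SimplexPoly.hahnNormSq κ n ν) •
              SimplexPoly.jacobiP κ ν) := by
  refine ⟨fun α _ => ⟨SimplexPoly.isMonicOrthogonal_monicR hκ α, fun R hR =>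
      hR.unique hκ (SimplexPoly.isMonicOrthogonal_monicR hκ α)⟩,
    fun ν hν => SimplexPoly.jacobiP_eq_sum_monicR hκ hν, fun α hα =>
      (SimplexPoly.isMonicOrthogonal_monicR hκ α).unique hκ
        (SimplexPoly.isMonicOrthogonal_jacobiExpansion hκ hα)⟩
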